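/- Base stations $x_1,x_2,\dots$ form a homogeneous Poisson point process $\Phi$ of intensity $\lambda>0$ on $\mathbb R^2$, and the typical user is at the origin. The surroundings of every base station are divided into $M\ge1$ equal angular sections (section $m$ contains the directions with angle in $[\frac{2\pi}{M}(m-1),\frac{2\pi}{M}m)$), and $\alpha_{im}$, the path-loss exponent in section $m$ of base station $i$, is uniform on $[\mu-\sqrt3\sigma,\mu+\sqrt3\sigma]$, where $\sigma>0$ and $\mu-\sqrt3\sigma>2$. Let $r_i=|x_i|$ and let $\alpha_i=\alpha_{im}$ for the section $m$ of base station $i$ that contains the user. Let $h_i$ be exponential with mean $1$ (Rayleigh fading), and let the antenna gain $G_i$ take the values $g_1=M_tM_r$, $g_2=M_tm_r$, $g_3=m_tM_r$, $g_4=m_tm_r$ with probabilities $p_1=q_tq_r$, $p_2=q_t(1-q_r)$, $p_3=(1-q_t)q_r$, $p_4=(1-q_t)(1-q_r)$, where $0<m_t\le M_t$, $0<m_r\le M_r$, $q_t=\frac{\phi_t}{2\pi}$, $q_r=\frac{\phi_r}{2\pi}$ and $\phi_t,\phi_r\in[0,2\pi]$. All $\alpha_{im},h_i,G_i$ are independent,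 and independent of $\Phi$. With transmit power $P_T>0$ and noise power $\sigma_n^2\ge0$ put $$\mathrm{SINR}(x_i)=\frac{P_TM_tM_rh_ir_i^{-\alpha_i}}{\sum_{j\ne i}P_TG_jh_jr_j^{-\alpha_j}+\sigma_n^2},$$ and let $P_C(\tau)=\Pr\{\sup_i\mathrm{SINR}(x_i)>\tau\}$. Then for every $\tau>\frac{M_tM_r}{m_tm_r}$ the integrals below converge and $$P_C(\tau)=\frac{\lambda\pi}{\sqrt3\sigma}\int_0^\infty\int_{\mu-\sqrt3\sigma}^{\mu+\sqrt3\sigma}r\exp\left(-\frac{\lambda\pi^2}{\sqrt3\sigma}\sum_{l=1}^4p_l\int_{\mu-\sqrt3\sigma}^{\mu+\sqrt3\sigma}\frac{\left(\frac{\tau r^{a}g_l}{M_tM_r}\right)^{2/\alpha}}{\alpha}\csc\left(\frac{2\pi}{\alpha}\right)d\alpha-\frac{\tau r^{a}\sigma_n^2}{P_TM_tM_r}\right)da\,dr.$$ Moreover, for bandwidth $B_W>0$, the rate coverage probability $P_R(\gamma)=\Pr\{B_W\log_2(1+\sup_i\mathrm{SINR}(x_i))>\gamma\}$ satisfies $P_R(\gamma)=P_C(2^{\gamma/B_W}-1)$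 for every $\gamma\in\mathbb R$. -/

import Mathlib

open MeasureTheory ProbabilityTheory
open scoped ENNReal

noncomputable section

/-! The plane `ℝ²` is `ℂ`, with its Lebesgue measure; the typical user is at the origin. -/

namespace SmallCell

/-! ### Poisson point processes -/

section PointProcess

variable {Ω : Type*} [MeasurableSpace Ω]

/-- The number of indices `i` such that the point `X i` lies in `B`. -/
def pointCount (X : ℕ → Ω → ℂ) (B : Set ℂ) (ω : Ω) : ℝ≥0∞ :=
  ∑' i, B.indicator (fun _ => (1 : ℝ≥0∞)) (X i ω)

/-- The random points `X 0, X 1, …` form a homogeneous Poisson point process of intensity `lam`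
on the plane: the number of points in a Borel set `B` of finite area is Poisson distributed with
mean `lam * area B`, and the numbers of points in pairwise disjoint Borel sets are independent. -/
structure IsHomogeneousPoisson (P : Measure Ω) (lam : ℝ) (X : ℕ → Ω → ℂ) : Prop where
  measurable : ∀ i, Measurable (X i)
  count_law : ∀ B : Set ℂ, MeasurableSet B → volume B ≠ ∞ →
    HasLaw (pointCount X B)
      ((poissonMeasure (lam.toNNReal * (volume B).toNNReal)).map (fun n : ℕ => (n : ℝ≥0∞))) P
  count_indep : ∀ (n : ℕ) (B : Fin n → Set ℂ), (∀ k, MeasurableSet (B k)) →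
    Pairwise (fun k l => Disjoint (B k) (B l)) → iIndepFun (fun k => pointCount X (B k)) P

end PointProcess

/-! ### Directions and sections -/

/-- The polar angle `θ ∈ [0, 2π)` of a point of the plane. -/
def polarAngle (x : ℂ) : ℝ := toIcoMod Real.two_pi_pos 0 x.arg

/-- The angle `Θ ∈ [0, 2π)` of the vector from a base station at `x` to the origin. -/
def userAngle (x : ℂ) : ℝ :=
  if polarAngle x < Real.pi then polarAngle x + Real.pi else polarAngle x - Real.pi

theorem userAngle_mem (x : ℂ) : 0 ≤ userAngle x ∧ userAngle x < 2 * Real.pi := by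
  have h : polarAngle x ∈ Set.Ico 0 (2 * Real.pi) := toIcoMod_mem_Ico' Real.two_pi_pos _
  have hp := Real.pi_pos
  obtain ⟨h0, h1⟩ := h
  unfold userAngle
  split_ifs with hlt
  · constructor <;> linarith
  · constructor <;> linarith

/-- The surroundings of a base station are divided into `M` equal angular sections, numbered
`0, …, M - 1`. For a base station at `x`, this is the section that contains the origin, i.e. the
`m` with `(2π / M) m ≤ Θ < (2π / M) (m + 1)`. -/
def userSection (M : ℕ) [NeZero M] (x : ℂ) : Fin M :=
  ⟨⌊userAngle x / (2 * Real.pi / M)⌋₊, by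
    have hM : (0 : ℝ) < M := by exact_mod_cast Nat.pos_of_ne_zero (NeZero.ne M)
    have h := userAngle_mem x
    have hp : (0 : ℝ) < 2 * Real.pi / M := by positivity
    rw [Nat.floor_lt (div_nonneg h.1 hp.le), div_lt_iff₀ hp, mul_div_cancel₀ _ hM.ne']
    exact h.2⟩

/-! ### Parameters of the network -/

/-- The deterministic parameters. -/
structure Params where
  /-- intensity of the base stations -/
  lam : ℝ
  /-- mean of the path loss exponent -/
  μ : ℝ
  /-- standard deviation of the path loss exponent -/
  σ : ℝ
  /-- transmission power -/
  PT : ℝ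
  /-- main lobe gain of a base station -/
  Mt : ℝ
  /-- main lobe gain of the user -/
  Mr : ℝ
  /-- side lobe gain of a base station -/
  mt : ℝ
  /-- side lobe gain of the user -/
  mr : ℝ
  /-- lobe width of a base station -/
  φt : ℝ
  /-- lobe width of the user -/
  φr : ℝ
  /-- noise power -/
  noise : ℝ
  /-- bandwidth -/
  BW : ℝ

/-- The ranges of the parameters. -/
structure Params.Admissible (S : Params) : Prop where
  lam_pos : 0 < S.lam
  σ_pos : 0 < S.σ
  two_lt : 2 < S.μ - √3 * S.σ
  PT_pos : 0 < S.PT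
  mt_pos : 0 < S.mt
  mr_pos : 0 < S.mr
  mt_le : S.mt ≤ S.Mt
  mr_le : S.mr ≤ S.Mr
  φt_nonneg : 0 ≤ S.φt
  φt_le : S.φt ≤ 2 * Real.pi
  φr_nonneg : 0 ≤ S.φr
  φr_le : S.φr ≤ 2 * Real.pi
  noise_nonneg : 0 ≤ S.noise
  BW_pos : 0 < S.BW

/-- The possible antenna gains `g₁, …, g₄` of an interfering link. -/
def Params.gain (S : Params) : Fin 4 → ℝ :=
  ![S.Mt * S.Mr, S.Mt * S.mr, S.mt * S.Mr, S.mt * S.mr]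

/-- The probabilities `p₁, …, p₄` of the antenna gains. -/
def Params.prob (S : Params) : Fin 4 → ℝ :=
  ![S.φt / (2 * Real.pi) * (S.φr / (2 * Real.pi)),
    S.φt / (2 * Real.pi) * (1 - S.φr / (2 * Real.pi)),
    (1 - S.φt / (2 * Real.pi)) * (S.φr / (2 * Real.pi)),
    (1 - S.φt / (2 * Real.pi)) * (1 - S.φr / (2 * Real.pi))]

/-- The law of the antenna gain of an interfering link. -/
def Params.gainLaw (S : Params) : Measure ℝ :=
  ∑ l, ENNReal.ofReal (S.prob l) • Measure.dirac (S.gain l)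

/-- The uniform law of the path loss exponent on `[μ - √3 σ, μ + √3 σ]`. -/
def Params.exponentLaw (S : Params) : Measure ℝ :=
  ProbabilityTheory.cond volume (Set.Icc (S.μ - √3 * S.σ) (S.μ + √3 * S.σ))

/-! ### The random network -/

section Network

variable {Ω : Type*} [MeasurableSpace Ω] {M : ℕ}

/-- All the random marks: path loss exponents `A i m`, fading gains `h i`, antenna gains `G i`. -/
def marks (A : ℕ → Fin M → Ω → ℝ) (h G : ℕ → Ω → ℝ) : (ℕ × Fin M) ⊕ (ℕ ⊕ ℕ) → Ω → ℝ :=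
  Sum.elim (fun q => A q.1 q.2) (Sum.elim h G)

/-- The random network: `X i` is the location of base station `i`, `A i m` the path loss exponent
in its section `m`, `h i` the power gain of the Rayleigh fading between it and the user, and `G i`
its antenna gain as an interferer. -/
structure IsNetwork (S : Params) (P : Measure Ω) (X : ℕ → Ω → ℂ) (A : ℕ → Fin M → Ω → ℝ)
    (h G : ℕ → Ω → ℝ) : Prop where
  poisson : IsHomogeneousPoisson P S.lam X
  measurable_A : ∀ i m, Measurable (A i m)
  measurable_h : ∀ i, Measurable (h i)
  measurable_G : ∀ i, Measurable (G i)
  law_A : ∀ i m, HasLaw (A i m) S.exponentLaw P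
  law_h : ∀ i, HasLaw (h i) (expMeasure 1) P
  law_G : ∀ i, HasLaw (G i) S.gainLaw P
  indep_marks : iIndepFun (marks A h G) P
  indep_points : IndepFun (fun ω i => X i ω) (fun ω k => marks A h G k ω) P

variable [NeZero M]

/-- The path loss `r ^ (-α)` of the link of base station `i`, where `r` is its distance from the
user and `α` is its path loss exponent in the section that contains the user. -/
def pathLoss (X : ℕ → Ω → ℂ) (A : ℕ → Fin M → Ω → ℝ) (i : ℕ) (ω : Ω) : ℝ :=
  ‖X i ω‖ ^ (-(A i (userSection M (X i ω)) ω))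

/-- The aggregate interference when the user is served by base station `i`. -/
def interference (S : Params) (X : ℕ → Ω → ℂ) (A : ℕ → Fin M → Ω → ℝ) (h G : ℕ → Ω → ℝ)
    (i : ℕ) (ω : Ω) : ℝ≥0∞ :=
  ∑' j : {j : ℕ // j ≠ i}, ENNReal.ofReal (S.PT * G j ω * h j ω * pathLoss X A j ω)

/-- The SINR of the link between the user and base station `i`. -/
def sinr (S : Params) (X : ℕ → Ω → ℂ) (A : ℕ → Fin M → Ω → ℝ) (h G : ℕ → Ω → ℝ)
    (i : ℕ) (ω : Ω) : ℝ≥0∞ :=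
  ENNReal.ofReal (S.PT * (S.Mt * S.Mr) * h i ω * pathLoss X A i ω) /
    (interference S X A h G i ω + ENNReal.ofReal S.noise)

/-- The SINR of the user under maximum SINR association. -/
def maxSinr (S : Params) (X : ℕ → Ω → ℂ) (A : ℕ → Fin M → Ω → ℝ) (h G : ℕ → Ω → ℝ)
    (ω : Ω) : ℝ≥0∞ :=
  ⨆ i, sinr S X A h G i ω

/-- The achievable rate `BW * log₂ (1 + max SINR)`. -/
def rate (S : Params) (X : ℕ → Ω → ℂ) (A : ℕ → Fin M → Ω → ℝ) (h G : ℕ → Ω → ℝ)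
    (ω : Ω) : EReal :=
  (S.BW : EReal) * (ENNReal.log (1 + maxSinr S X A h G ω) / ((Real.log 2 : ℝ) : EReal))

/-- The SINR coverage probability `P_C(τ)`. -/
def coverageProb (S : Params) (P : Measure Ω) (X : ℕ → Ω → ℂ) (A : ℕ → Fin M → Ω → ℝ)
    (h G : ℕ → Ω → ℝ) (τ : ℝ) : ℝ :=
  P.real {ω | (τ : EReal) < ((maxSinr S X A h G ω : ℝ≥0∞) : EReal)}

/-- The rate coverage probability `P_R(γ)`. -/
def rateCoverageProb (S : Params) (P : Measure Ω) (X : ℕ → Ω → ℂ) (A : ℕ → Fin M → Ω → ℝ)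
    (h G : ℕ → Ω → ℝ) (γ : ℝ) : ℝ :=
  P.real {ω | (γ : EReal) < rate S X A h G ω}

end Network

/-! ### The coverage integral -/

/-- The function of `α` in the innermost integral, for the gain `g_l`, at distance `r` and path
loss exponent `a` of the serving link: `(τ r^a g_l / (Mt Mr))^(2/α) / α * csc (2π/α)`. -/
def Params.innerIntegrand (S : Params) (τ r a : ℝ) (l : Fin 4) (α : ℝ) : ℝ :=
  (τ * r ^ a * S.gain l / (S.Mt * S.Mr)) ^ (2 / α) / α * (1 / Real.sin (2 * Real.pi / α))

/-- The function of `(r, a)` in the double integral. -/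
def Params.outerIntegrand (S : Params) (τ r a : ℝ) : ℝ :=
  r * Real.exp
    (-(S.lam * Real.pi ^ 2 / (√3 * S.σ) *
        ∑ l, S.prob l *
          ∫ α in (S.μ - √3 * S.σ)..(S.μ + √3 * S.σ), S.innerIntegrand τ r a l α)
      - τ * r ^ a * S.noise / (S.PT * S.Mt * S.Mr))

end SmallCell

end

/-!
Why the formula holds. Suppose that the SINR of base station `i` exceeds
`τ > M_t M_r / (m_t m_r)`. Every other station `j` interferes with antenna gain at least
`m_t m_r`, so the main lobe power of `j` is smaller than that of `i` (`power_lt_of_lt_sinr`). Hence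
at most one station has SINR above `τ`, and the probability that the supremum exceeds `τ` is
the sum over `i` of the probabilities that the SINR of station `i` does. This is where the lower
bound on `τ` enters.

The fading gain of the serving station is exponential, so given its location `x`, its path loss
exponent `a` and the interference `I`, its SINR exceeds `τ` with probability `e^{-v (I + N)}`,
where `v = τ ‖x‖ ^ a / (P_T M_t M_r)` and `N` is the noise power (`IsNetwork.measure_lt_fading`).
Given the locations, the path loss exponents, fading gains and antenna gains of the links are
independent triples with one common law, whatever sections contain the user. So the expectation of
`e^{-v I}` is a product over the interfering stations of a function of their location alone, the
Laplace transform `Params.powerLaplace` of the received power. What remains is an expectation over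
the Poisson process of a sum over `i` of a functional of the other points, which the
Campbell–Mecke formula evaluates (`IsHomogeneousPoisson.mecke`, `IsNetwork.measure_lt_maxSinr`).

Mathlib has no Poisson point processes, so this formula is derived from the laws and the
independence of the point counts. They give the Laplace functional
`E exp (-∑ f (X j)) = exp (-λ ∫ (1 - e^{-f}))` for simple functions, and then for all measurable `f ≥ 0`.
Its derivative in the direction of an indicator function is the Campbell–Mecke formula for a
functional that does not depend on the distinguished point; the dependence on the point through
`v` is recovered by approximating `v` by simple functions. All of this takes place in `[0, ∞]`,
where sums and integrals always make sense, with `expNeg` for `u ↦ e^{-u}`.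

The Laplace exponent `λ ∫ (1 - powerLaplace v y) dy` is computed by writing `1 - e^{-w}` as the
probability that an exponential variable `T` is at most `w`. For a link with path loss exponent
`α`, fading gain `h` and antenna gain `g` the locations `y` with `T ≤ v P_T g h ‖y‖ ^ (-α)` form a
disc of area `π (v P_T g h / T) ^ (2 / α)`. Its mean over `h` and `T` involves
`Γ(1 + z) Γ(1 - z) = π z / sin (π z)` with `z = 2 / α < 1`, whence the cosecant
(`lintegral_fading_ratio`). Polar coordinates turn the integral over `x` into the integral over `r`.
The double integral converges because it is a positive multiple of a probability.

The statement on the rate holds because the rate is a strictly increasing function of the SINR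
(`lt_rate_iff`).
-/

noncomputable section

namespace SmallCell

open Filter Topology Set

/-! ### The function `e^{-u}` on `[0, ∞]` -/

/-- The function `u ↦ e^{-u}` from `[0, ∞]` to `[0, ∞]`, with `e^{-∞} = 0`. -/
def expNeg (u : ℝ≥0∞) : ℝ≥0∞ := EReal.exp (-(u : EReal))

theorem expNeg_zero : expNeg 0 = 1 := by simp [expNeg]

theorem expNeg_top : expNeg ∞ = 0 := by simp [expNeg]

theorem expNeg_add (u v : ℝ≥0∞) : expNeg (u + v) = expNeg u * expNeg v := by
  unfold expNeg
  rw [← EReal.exp_add, EReal.coe_ennreal_add, EReal.neg_add]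
  · rw [sub_eq_add_neg]
  · left; exact EReal.coe_ennreal_ne_bot _
  · right; exact EReal.coe_ennreal_ne_bot _

theorem continuous_expNeg : Continuous expNeg :=
  ENNReal.continuous_exp.comp (continuous_neg.comp continuous_coe_ennreal_ereal)

@[fun_prop]
theorem measurable_expNeg : Measurable expNeg := continuous_expNeg.measurable

theorem expNeg_strictAnti : StrictAnti expNeg := fun u v huv => by
  unfold expNeg
  rw [EReal.exp_lt_exp_iff, EReal.neg_lt_neg_iff]
  exact_mod_cast huv

theorem expNeg_antitone : Antitone expNeg := expNeg_strictAnti.antitone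

theorem expNeg_le_one (u : ℝ≥0∞) : expNeg u ≤ 1 := expNeg_zero ▸ expNeg_antitone bot_le

theorem expNeg_ne_top (u : ℝ≥0∞) : expNeg u ≠ ∞ := ((expNeg_le_one u).trans_lt ENNReal.one_lt_top).ne

theorem expNeg_ne_zero {u : ℝ≥0∞} (hu : u ≠ ∞) : expNeg u ≠ 0 := by
  rw [← expNeg_top]; exact expNeg_strictAnti.injective.ne hu

theorem expNeg_ofReal {x : ℝ} (hx : 0 ≤ x) :
    expNeg (ENNReal.ofReal x) = ENNReal.ofReal (Real.exp (-x)) := by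
  unfold expNeg
  rw [EReal.coe_ennreal_ofReal, max_eq_left hx, ← EReal.coe_neg, EReal.exp_coe]

theorem expNeg_finset_sum {ι : Type*} (s : Finset ι) (f : ι → ℝ≥0∞) :
    expNeg (∑ i ∈ s, f i) = ∏ i ∈ s, expNeg (f i) := by
  classical
  induction s using Finset.induction_on with
  | empty => simp [expNeg_zero]
  | insert a s ha ih => rw [Finset.sum_insert ha, Finset.prod_insert ha, expNeg_add, ih]

/-- The inverse of `expNeg`: minus the logarithm of `w`, for `w ≤ 1`. -/
def negLog (w : ℝ≥0∞) : ℝ≥0∞ := (-(ENNReal.log w)).toENNReal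

theorem expNeg_negLog {w : ℝ≥0∞} (hw : w ≤ 1) : expNeg (negLog w) = w := by
  unfold expNeg negLog
  rw [EReal.coe_toENNReal, neg_neg, ENNReal.exp_log]
  rw [EReal.neg_nonneg]
  exact ENNReal.log_le_zero_iff.2 hw

theorem continuous_negLog : Continuous negLog :=
  EReal.continuous_toENNReal.comp (continuous_neg.comp ENNReal.continuous_log)

@[fun_prop]
theorem measurable_negLog : Measurable negLog := continuous_negLog.measurable

theorem negLog_antitone : Antitone negLog := fun _ _ huv =>
  EReal.toENNReal_le_toENNReal (EReal.neg_le_neg_iff.2 (ENNReal.log_monotone huv))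

theorem negLog_ne_top {w : ℝ≥0∞} (hw : w ≤ 1) (h0 : w ≠ 0) : negLog w ≠ ∞ := fun h =>
  h0 (by rw [← expNeg_negLog hw, h, expNeg_top])

/-! ### Laplace functional of a Poisson process -/

section PointProcess

variable {Ω : Type*} [MeasurableSpace Ω] {P : Measure Ω} {lam : ℝ} {X : ℕ → Ω → ℂ}

theorem measurable_pointCount (hX : ∀ i, Measurable (X i)) {B : Set ℂ} (hB : MeasurableSet B) :
    Measurable (pointCount X B) := by
  unfold pointCount
  exact Measurable.tsum fun i => (measurable_const.indicator hB).comp (hX i)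

theorem lintegral_poissonMeasure (r : NNReal) (f : ℕ → ℝ≥0∞) :
    ∫⁻ n, f n ∂(poissonMeasure r) =
      ∑' n : ℕ, ENNReal.ofReal (Real.exp (-r) * r ^ n / n.factorial) * f n := by
  rw [poissonMeasure, lintegral_sum_measure]
  simp [lintegral_smul_measure]

/-- The Laplace transform of the Poisson law. -/
theorem lintegral_expNeg_poissonMeasure (r : NNReal) {c : ℝ≥0∞} (hc : c ≠ ∞) :
    ∫⁻ n : ℕ, expNeg (c * n) ∂(poissonMeasure r) = expNeg (r * (1 - expNeg c)) := by
  lift c to NNReal using hc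
  have hc0 : 0 ≤ (c : ℝ) := c.2
  have hr0 : 0 ≤ (r : ℝ) := r.2
  have h1 : expNeg c = ENNReal.ofReal (Real.exp (-c)) := by
    rw [← expNeg_ofReal hc0, ENNReal.ofReal_coe_nnreal]
  have hle : Real.exp (-(c : ℝ)) ≤ 1 := by rw [Real.exp_le_one_iff]; linarith
  have h2 : (r : ℝ≥0∞) * (1 - expNeg c) = ENNReal.ofReal (r * (1 - Real.exp (-c))) := by
    rw [h1, ENNReal.ofReal_mul hr0, ENNReal.ofReal_coe_nnreal,
      ENNReal.ofReal_sub _ (Real.exp_nonneg _), ENNReal.ofReal_one]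
  have h3 : ∀ n : ℕ, expNeg ((c : ℝ≥0∞) * n) = ENNReal.ofReal (Real.exp (-c) ^ n) := fun n => by
    rw [← Real.exp_nat_mul, show (n : ℝ) * -(c : ℝ) = -(c * n) by ring, ← expNeg_ofReal (by positivity),
      ENNReal.ofReal_mul hc0]
    simp
  rw [lintegral_poissonMeasure, h2, expNeg_ofReal (mul_nonneg hr0 (by linarith))]
  have h4 : HasSum (fun n : ℕ => Real.exp (-r) * r ^ n / n.factorial * Real.exp (-c) ^ n)
      (Real.exp (-(r * (1 - Real.exp (-c))))) := by
    have := (NormedSpace.expSeries_div_hasSum_exp (r * Real.exp (-c) : ℝ)).mul_left (Real.exp (-r))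
    rw [← Real.exp_eq_exp_ℝ, ← Real.exp_add] at this
    convert! this using 1
    · ext n; rw [mul_pow]; ring
    · congr 1; ring
  rw [← h4.tsum_eq, ENNReal.ofReal_tsum_of_nonneg (fun n => by positivity) h4.summable]
  congr 1 with n
  rw [h3, ENNReal.ofReal_mul (by positivity)]

theorem lintegral_natCast_poissonMeasure (r : NNReal) :
    ∫⁻ n : ℕ, (n : ℝ≥0∞) ∂(poissonMeasure r) = r := by
  have hr0 : 0 ≤ (r : ℝ) := r.2
  rw [lintegral_poissonMeasure, tsum_eq_zero_add' ENNReal.summable]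
  have : ∀ n : ℕ, ENNReal.ofReal (Real.exp (-r) * r ^ (n + 1) / (n + 1).factorial) * ((n + 1 : ℕ) : ℝ≥0∞)
      = r * ENNReal.ofReal (Real.exp (-r) * r ^ n / n.factorial) := fun n => by
    rw [← ENNReal.ofReal_natCast, ← ENNReal.ofReal_mul (by positivity),
      ← ENNReal.ofReal_coe_nnreal, ← ENNReal.ofReal_mul hr0]
    congr 1
    rw [Nat.factorial_succ]; push_cast
    field_simp
    ring
  simp_rw [this]
  rw [ENNReal.tsum_mul_left, ← ENNReal.ofReal_tsum_of_nonneg (fun n => by positivity)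
    (hasSum_one_poissonMeasure r).summable, (hasSum_one_poissonMeasure r).tsum_eq]
  simp

theorem IsHomogeneousPoisson.lintegral_comp_pointCount (h : IsHomogeneousPoisson P lam X)
    {B : Set ℂ} (hB : MeasurableSet B) (hv : volume B ≠ ∞) {φ : ℝ≥0∞ → ℝ≥0∞} (hφ : Measurable φ) :
    ∫⁻ ω, φ (pointCount X B ω) ∂P =
      ∫⁻ n : ℕ, φ n ∂(poissonMeasure (lam.toNNReal * (volume B).toNNReal)) := by
  have h1 := h.count_law B hB hv
  rw [← lintegral_map' hφ.aemeasurable h1.aemeasurable, h1.map_eq, lintegral_map hφ .of_discrete]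

theorem IsHomogeneousPoisson.lintegral_pointCount (h : IsHomogeneousPoisson P lam X)
    {B : Set ℂ} (hB : MeasurableSet B) (hv : volume B ≠ ∞) :
    ∫⁻ ω, pointCount X B ω ∂P = ENNReal.ofReal lam * volume B := by
  refine (h.lintegral_comp_pointCount hB hv (φ := id) measurable_id).trans ?_
  simp only [id]
  rw [lintegral_natCast_poissonMeasure, ENNReal.coe_mul, ENNReal.coe_toNNReal hv]
  rfl

theorem IsHomogeneousPoisson.lintegral_expNeg_pointCount (h : IsHomogeneousPoisson P lam X)
    {B : Set ℂ} (hB : MeasurableSet B) (hv : volume B ≠ ∞) {c : ℝ≥0∞} (hc : c ≠ ∞) :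
    ∫⁻ ω, expNeg (c * pointCount X B ω) ∂P =
      expNeg (ENNReal.ofReal lam * ((1 - expNeg c) * volume B)) := by
  rw [h.lintegral_comp_pointCount hB hv (φ := fun x => expNeg (c * x))
    (measurable_expNeg.comp (measurable_const.mul measurable_id)),
    lintegral_expNeg_poissonMeasure _ hc, ENNReal.coe_mul, ENNReal.coe_toNNReal hv,
    mul_assoc, mul_comm (volume B)]
  rfl

/-- The sum of a simple function over the points is a combination of point counts in disjoint
sets. -/
theorem tsum_simpleFunc_comp {Ω : Type*} {X : ℕ → Ω → ℂ} (f : SimpleFunc ℂ ℝ≥0∞) (ω : Ω) :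
    ∑' j, f (X j ω) = ∑ y ∈ f.range, y * pointCount X (f ⁻¹' {y}) ω := by
  unfold pointCount
  simp_rw [← ENNReal.tsum_mul_left]
  rw [← Summable.tsum_finsetSum fun _ _ => ENNReal.summable]
  refine tsum_congr fun j => ?_
  rw [Finset.sum_eq_single (f (X j ω))]
  · simp
  · intro b _ hb
    rw [indicator_of_notMem, mul_zero]
    simpa using hb.symm
  · intro hb
    exact absurd (f.mem_range_self _) hb

/-- The Laplace functional at a simple function: the level sets are disjoint, so their point counts
are independent Poisson variables. -/
theorem IsHomogeneousPoisson.laplace_simpleFunc [IsProbabilityMeasure P]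
    (h : IsHomogeneousPoisson P lam X)
    (f : SimpleFunc ℂ ℝ≥0∞) (hf : ∀ x, f x ≠ ∞) (hv : ∀ y ≠ 0, volume (f ⁻¹' {y}) ≠ ∞) :
    ∫⁻ ω, expNeg (∑' j, f (X j ω)) ∂P =
      expNeg (ENNReal.ofReal lam * ∫⁻ x, (1 - expNeg (f x))) := by
  classical
  simp_rw [tsum_simpleFunc_comp, expNeg_finset_sum]
  have hind : iIndepFun (fun y : f.range => pointCount X (f ⁻¹' {y.1})) P := by
    let e := f.range.equivFin
    have := h.count_indep f.range.card (fun k => f ⁻¹' {(e.symm k).1})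
      (fun k => f.measurableSet_preimage _) (fun k l hkl => by
        refine Disjoint.preimage _ ?_
        rw [Set.disjoint_singleton]
        intro h'
        exact hkl (e.symm.injective (Subtype.ext h')))
    have h2 := this.precomp e.injective
    simpa using h2
  have hind2 := hind.comp (fun y x => expNeg (y.1 * x))
    (fun y => measurable_expNeg.comp (measurable_const.mul measurable_id))
  have h3 : ∫⁻ ω, ∏ y ∈ f.range, expNeg (y * pointCount X (f ⁻¹' {y}) ω) ∂P =
      ∏ y ∈ f.range, ∫⁻ ω, expNeg (y * pointCount X (f ⁻¹' {y}) ω) ∂P := by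
    have := lintegral_prod_eq_prod_lintegral_of_indepFun Finset.univ _ hind2
      (fun y => measurable_expNeg.comp (measurable_const.mul
        (measurable_pointCount h.measurable (f.measurableSet_preimage _))))
    simp only [Function.comp] at this
    rw [← Finset.prod_coe_sort f.range (fun y => ∫⁻ ω, expNeg (y * pointCount X (f ⁻¹' {y}) ω) ∂P),
      ← this]
    congr 1 with ω
    rw [← Finset.prod_coe_sort f.range (fun y => expNeg (y * pointCount X (f ⁻¹' {y}) ω))]
  rw [h3]
  have h4 : ∫⁻ x, (1 - expNeg (f x)) = ∑ y ∈ f.range, (1 - expNeg y) * volume (f ⁻¹' {y}) := by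
    rw [← SimpleFunc.map_lintegral (fun y => 1 - expNeg y) f, ← SimpleFunc.lintegral_eq_lintegral]
    rfl
  rw [h4, Finset.mul_sum, expNeg_finset_sum]
  refine Finset.prod_congr rfl fun y hy => ?_
  by_cases hy0 : y = 0
  · simp [hy0, expNeg_zero]
  · obtain ⟨x, rfl⟩ := SimpleFunc.mem_range.1 hy
    exact h.lintegral_expNeg_pointCount (f.measurableSet_preimage _) (hv _ hy0) (hf x)

theorem tendsto_tsum_of_monotone {f : ℕ → ℕ → ℝ≥0∞} {F : ℕ → ℝ≥0∞}
    (hm : ∀ j, Monotone fun n => f n j) (hf : ∀ j, Tendsto (fun n => f n j) atTop (𝓝 (F j))) :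
    Tendsto (fun n => ∑' j, f n j) atTop (𝓝 (∑' j, F j)) := by
  simp_rw [← lintegral_count]
  exact lintegral_tendsto_of_tendsto_of_monotone (fun n => (measurable_of_countable _).aemeasurable)
    (ae_of_all _ hm) (ae_of_all _ hf)

/-- The Laplace functional of a homogeneous Poisson process. -/
theorem IsHomogeneousPoisson.laplace [IsProbabilityMeasure P]
    (h : IsHomogeneousPoisson P lam X) {f : ℂ → ℝ≥0∞} (hf : Measurable f) :
    ∫⁻ ω, expNeg (∑' j, f (X j ω)) ∂P =
      expNeg (ENNReal.ofReal lam * ∫⁻ x, (1 - expNeg (f x))) := by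
  -- simple functions increasing to `f`, cut off so that their nonzero level sets have finite area
  let F : ℕ → SimpleFunc ℂ ℝ≥0∞ := fun n =>
    (SimpleFunc.eapprox f n).restrict (Metric.ball 0 n)
  have hFx : ∀ n x, F n x = (Metric.ball (0 : ℂ) n).indicator (SimpleFunc.eapprox f n) x := fun n x => by
    rw [SimpleFunc.restrict_apply _ measurableSet_ball]
  have hmono : ∀ x, Monotone fun n => F n x := fun x m n hmn => by
    simp only [hFx]
    refine (indicator_le_indicator_of_subset (Metric.ball_subset_ball (by exact_mod_cast hmn))
      (fun _ => bot_le) x).trans (indicator_le_indicator (SimpleFunc.monotone_eapprox f hmn x))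
  have hlim : ∀ x, Tendsto (fun n => F n x) atTop (𝓝 (f x)) := fun x => by
    refine (SimpleFunc.tendsto_eapprox hf x).congr' ?_
    obtain ⟨N, hN⟩ := exists_nat_gt ‖x‖
    filter_upwards [eventually_ge_atTop N] with n hn
    rw [hFx, indicator_of_mem]
    rw [mem_ball_zero_iff]
    exact hN.trans_le (by exact_mod_cast hn)
  have hsimple : ∀ n, ∫⁻ ω, expNeg (∑' j, F n (X j ω)) ∂P =
      expNeg (ENNReal.ofReal lam * ∫⁻ x, (1 - expNeg (F n x))) := fun n => by
    refine h.laplace_simpleFunc (F n) (fun x => ?_) (fun y hy => ?_)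
    · rw [hFx]
      refine ((indicator_le_self _ _ x).trans_lt (SimpleFunc.eapprox_lt_top f n x)).ne
    · refine ((measure_mono ?_).trans_lt (measure_ball_lt_top (x := (0 : ℂ)) (r := n))).ne
      intro x hx
      by_contra hx'
      refine hy ?_
      rw [← show F n x = y from hx, hFx, indicator_of_notMem hx']
  have hL : Tendsto (fun n => ∫⁻ ω, expNeg (∑' j, F n (X j ω)) ∂P) atTop
      (𝓝 (∫⁻ ω, expNeg (∑' j, f (X j ω)) ∂P)) := by
    refine tendsto_lintegral_of_dominated_convergence (fun _ => 1) (fun n => ?_)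
      (fun n => ae_of_all _ fun ω => expNeg_le_one _) (by simp) (ae_of_all _ fun ω => ?_)
    · exact measurable_expNeg.comp (Measurable.tsum fun j =>
        (F n).measurable.comp (h.measurable j))
    · exact (continuous_expNeg.tendsto _).comp
        (tendsto_tsum_of_monotone (fun j => hmono _) (fun j => hlim _))
  have hR : Tendsto (fun n => expNeg (ENNReal.ofReal lam * ∫⁻ x, (1 - expNeg (F n x)))) atTop
      (𝓝 (expNeg (ENNReal.ofReal lam * ∫⁻ x, (1 - expNeg (f x))))) := by
    refine (continuous_expNeg.tendsto _).comp (ENNReal.Tendsto.const_mul ?_ (Or.inr ENNReal.ofReal_ne_top))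
    refine lintegral_tendsto_of_tendsto_of_monotone
      (fun n => (measurable_const.sub (measurable_expNeg.comp (F n).measurable)).aemeasurable)
      (ae_of_all _ fun x m n hmn => tsub_le_tsub_left (expNeg_antitone (hmono x hmn)) _)
      (ae_of_all _ fun x => ?_)
    exact ENNReal.Tendsto.sub tendsto_const_nhds ((continuous_expNeg.tendsto _).comp (hlim x))
      (Or.inl ENNReal.one_ne_top)
  refine tendsto_nhds_unique hL ?_
  simp_rw [hsimple]
  exact hR

/-! ### The Campbell–Mecke formula -/

theorem one_sub_expNeg_le (u : ℝ≥0∞) : 1 - expNeg u ≤ u := by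
  rcases eq_or_ne u ∞ with rfl | hu
  · exact le_top
  lift u to NNReal using hu
  have hu0 : 0 ≤ (u : ℝ) := u.2
  rw [← ENNReal.ofReal_coe_nnreal, expNeg_ofReal hu0, ← ENNReal.ofReal_one,
    ← ENNReal.ofReal_sub _ (Real.exp_nonneg _)]
  exact ENNReal.ofReal_le_ofReal (by linarith [Real.add_one_le_exp (-(u : ℝ))])

theorem div_one_add_le_one_sub_expNeg {u : ℝ≥0∞} (hu : u ≠ ∞) : u / (1 + u) ≤ 1 - expNeg u := by
  lift u to NNReal using hu
  have hu0 : 0 ≤ (u : ℝ) := u.2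
  rw [← ENNReal.ofReal_coe_nnreal, expNeg_ofReal hu0, ← ENNReal.ofReal_one,
    ← ENNReal.ofReal_sub _ (Real.exp_nonneg _), ← ENNReal.ofReal_add zero_le_one hu0,
    ← ENNReal.ofReal_div_of_pos (by positivity)]
  refine ENNReal.ofReal_le_ofReal ?_
  have h1 : Real.exp (-(u : ℝ)) ≤ 1 / (1 + u) := by
    rw [Real.exp_neg, ← one_div]
    exact one_div_le_one_div_of_le (by positivity) (by linarith [Real.add_one_le_exp (u : ℝ)])
  have h2 : (u : ℝ) / (1 + u) = 1 - 1 / (1 + u) := by field_simp; ring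
  linarith

/-- `1 - e^{-u} ∼ u` as `u → 0`, in the form used for a derivative at `0`. -/
theorem tendsto_mul_one_sub_expNeg {u : ℕ → ℝ≥0∞} {c : ℝ≥0∞} (hu : ∀ n, u n ≠ ∞) (hc : c ≠ ∞)
    (h : Tendsto (fun n : ℕ => ((n + 1 : ℕ) : ℝ≥0∞) * u n) atTop (𝓝 c)) :
    Tendsto (fun n : ℕ => ((n + 1 : ℕ) : ℝ≥0∞) * (1 - expNeg (u n))) atTop (𝓝 c) := by
  have hn : Tendsto (fun n : ℕ => ((n + 1 : ℕ) : ℝ≥0∞)) atTop (𝓝 ∞) :=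
    ENNReal.tendsto_nat_nhds_top.comp (tendsto_add_atTop_nat 1)
  have hu0 : Tendsto u atTop (𝓝 0) := by
    have h1 := ENNReal.Tendsto.div h (Or.inr ENNReal.top_ne_zero) hn (Or.inr hc)
    rw [ENNReal.div_top] at h1
    refine h1.congr fun n => ?_
    rw [mul_comm, ENNReal.mul_div_cancel_right (by simp) (ENNReal.natCast_ne_top _)]
  have hlow : Tendsto (fun n : ℕ => ((n + 1 : ℕ) : ℝ≥0∞) * u n / (1 + u n)) atTop (𝓝 c) := by
    have h1 : Tendsto (fun n => 1 + u n) atTop (𝓝 (1 + 0)) := tendsto_const_nhds.add hu0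
    rw [add_zero] at h1
    have := ENNReal.Tendsto.div h (Or.inr one_ne_zero) h1 (Or.inl ENNReal.one_ne_top)
    rwa [div_one] at this
  refine tendsto_of_tendsto_of_tendsto_of_le_of_le hlow h (fun n => ?_) (fun n => ?_)
  · rw [mul_div_assoc]
    exact mul_le_mul_right (div_one_add_le_one_sub_expNeg (hu n)) _
  · exact mul_le_mul_right (one_sub_expNeg_le _) _

theorem one_sub_mul_eq {a b : ℝ≥0∞} (ha : a ≤ 1) (hb : b ≤ 1) :
    1 - a * b = (1 - a) + a * (1 - b) := by
  have ha' : a ≠ ∞ := (ha.trans_lt ENNReal.one_lt_top).ne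
  rw [ENNReal.mul_sub (fun _ _ => ha'), mul_one, tsub_add_tsub_cancel ha (mul_le_of_le_one_right' hb)]

/-- The Laplace functional at `f + t • 1_B`, as a function of `t`. -/
theorem IsHomogeneousPoisson.lintegral_expNeg_add_indicator [IsProbabilityMeasure P]
    (h : IsHomogeneousPoisson P lam X) {f : ℂ → ℝ≥0∞} (hf : Measurable f) {B : Set ℂ}
    (hB : MeasurableSet B) (t : ℝ≥0∞) :
    ∫⁻ ω, expNeg (t * pointCount X B ω) * expNeg (∑' j, f (X j ω)) ∂P =
      expNeg (ENNReal.ofReal lam * (∫⁻ x in B, expNeg (f x)) * (1 - expNeg t)) *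
      expNeg (ENNReal.ofReal lam * ∫⁻ x, (1 - expNeg (f x))) := by
  have h1 : ∀ ω, expNeg (t * pointCount X B ω) * expNeg (∑' j, f (X j ω)) =
      expNeg (∑' j, (f (X j ω) + t * B.indicator (fun _ => 1) (X j ω))) := fun ω => by
    rw [ENNReal.tsum_add, ENNReal.tsum_mul_left, expNeg_add, mul_comm]; rfl
  have hind : Measurable (B.indicator (fun _ => (1 : ℝ≥0∞))) := measurable_const.indicator hB
  have h2 : ∀ x, 1 - expNeg (f x + t * B.indicator (fun _ => 1) x) =
      (1 - expNeg (f x)) + B.indicator (fun x => expNeg (f x)) x * (1 - expNeg t) := fun x => by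
    rw [expNeg_add, one_sub_mul_eq (expNeg_le_one _) (expNeg_le_one _)]
    by_cases hx : x ∈ B <;> simp [hx, expNeg_zero]
  simp_rw [h1]
  rw [h.laplace (f := fun x => f x + t * B.indicator (fun _ => 1) x)
    (hf.add (measurable_const.mul hind))]
  simp_rw [h2]
  have hm : Measurable fun x => 1 - expNeg (f x) := by fun_prop
  have hm' : Measurable (B.indicator fun x => expNeg (f x)) :=
    (measurable_expNeg.comp hf).indicator hB
  rw [lintegral_add_left hm, lintegral_mul_const _ hm', lintegral_indicator hB,
    mul_add, expNeg_add, mul_comm, mul_assoc]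

/-- The Campbell–Mecke formula for a set and a function that does not depend on the point. It is
the derivative of the Laplace functional in the direction of the indicator function of the set. -/
theorem IsHomogeneousPoisson.lintegral_pointCount_mul_expNeg [IsProbabilityMeasure P]
    (h : IsHomogeneousPoisson P lam X) {f : ℂ → ℝ≥0∞} (hf : Measurable f) {B : Set ℂ}
    (hB : MeasurableSet B) (hv : volume B ≠ ∞) :
    ∫⁻ ω, pointCount X B ω * expNeg (∑' j, f (X j ω)) ∂P =
      ENNReal.ofReal lam * (∫⁻ x in B, expNeg (f x)) *
      expNeg (ENNReal.ofReal lam * ∫⁻ x, (1 - expNeg (f x))) := by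
  set Z : Ω → ℝ≥0∞ := fun ω => expNeg (∑' j, f (X j ω)) with hZ
  set c := ENNReal.ofReal lam * (∫⁻ x in B, expNeg (f x)) with hc
  set l := expNeg (ENNReal.ofReal lam * ∫⁻ x, (1 - expNeg (f x))) with hl
  have hZm : Measurable Z := measurable_expNeg.comp (Measurable.tsum fun j => hf.comp (h.measurable j))
  have hNm : Measurable (pointCount X B) := measurable_pointCount h.measurable hB
  have hNint : ∫⁻ ω, pointCount X B ω ∂P ≠ ∞ := by
    rw [h.lintegral_pointCount hB hv]
    exact ENNReal.mul_ne_top ENNReal.ofReal_ne_top hv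
  have hctop : c ≠ ∞ := by
    refine ENNReal.mul_ne_top ENNReal.ofReal_ne_top (ne_top_of_le_ne_top hv ?_)
    calc ∫⁻ x in B, expNeg (f x) ≤ ∫⁻ x in B, 1 := lintegral_mono fun x => expNeg_le_one _
      _ = volume B := by simp
  -- difference quotients in the direction of the indicator function, with step `1 / (n + 1)`
  let t : ℕ → ℝ≥0∞ := fun n => ((n + 1 : ℕ) : ℝ≥0∞)⁻¹
  have ht : ∀ n, ((n + 1 : ℕ) : ℝ≥0∞) * t n = 1 := fun n =>
    ENNReal.mul_inv_cancel (by simp) (ENNReal.natCast_ne_top _)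
  have httop : ∀ n, t n ≠ ∞ := fun n => ENNReal.inv_ne_top.2 (by simp)
  have hid : ∀ n, ∫⁻ ω, ((n + 1 : ℕ) : ℝ≥0∞) * (1 - expNeg (t n * pointCount X B ω)) * Z ω ∂P =
      ((n + 1 : ℕ) : ℝ≥0∞) * (1 - expNeg (c * (1 - expNeg (t n)))) * l := fun n => by
    have hm : Measurable fun ω => expNeg (t n * pointCount X B ω) :=
      measurable_expNeg.comp (measurable_const.mul hNm)
    simp_rw [mul_assoc]
    have hm' : Measurable fun ω => (1 - expNeg (t n * pointCount X B ω)) * Z ω := by fun_prop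
    rw [lintegral_const_mul _ hm']
    congr 1
    have e1 : ∀ ω, (1 - expNeg (t n * pointCount X B ω)) * Z ω =
        Z ω - expNeg (t n * pointCount X B ω) * Z ω := fun ω => by
      rw [ENNReal.sub_mul (fun _ _ => expNeg_ne_top _), one_mul]
    simp_rw [e1]
    have hfin : ∫⁻ ω, expNeg (t n * pointCount X B ω) * Z ω ∂P ≠ ∞ := by
      rw [h.lintegral_expNeg_add_indicator hf hB]
      exact ENNReal.mul_ne_top (expNeg_ne_top _) (expNeg_ne_top _)
    have hm₂ : Measurable fun ω => expNeg (t n * pointCount X B ω) * Z ω := hm.mul hZm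
    rw [lintegral_sub hm₂ hfin (ae_of_all _ fun ω => mul_le_of_le_one_left' (expNeg_le_one _)),
      h.lintegral_expNeg_add_indicator hf hB, h.laplace hf,
      ENNReal.sub_mul (fun _ _ => expNeg_ne_top _), one_mul]
  have hL : Tendsto (fun n : ℕ => ∫⁻ ω, ((n + 1 : ℕ) : ℝ≥0∞) *
      (1 - expNeg (t n * pointCount X B ω)) * Z ω ∂P) atTop
      (𝓝 (∫⁻ ω, pointCount X B ω * Z ω ∂P)) := by
    refine tendsto_lintegral_of_dominated_convergence (pointCount X B) (fun n => ?_)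
      (fun n => ae_of_all _ fun ω => ?_) hNint ?_
    · exact (measurable_const.mul (measurable_const.sub
        (measurable_expNeg.comp (measurable_const.mul hNm)))).mul hZm
    · calc ((n + 1 : ℕ) : ℝ≥0∞) * (1 - expNeg (t n * pointCount X B ω)) * Z ω
          ≤ ((n + 1 : ℕ) : ℝ≥0∞) * (t n * pointCount X B ω) * 1 :=
            mul_le_mul' (mul_le_mul_right (one_sub_expNeg_le _) _) (expNeg_le_one _)
        _ = pointCount X B ω := by rw [mul_one, ← mul_assoc, ht, one_mul]
    · filter_upwards [ae_lt_top hNm hNint] with ω hω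
      refine ENNReal.Tendsto.mul_const ?_ (Or.inr (expNeg_ne_top _))
      refine tendsto_mul_one_sub_expNeg (fun n => ENNReal.mul_ne_top (httop n) hω.ne) hω.ne ?_
      simp_rw [← mul_assoc, ht, one_mul]
      exact tendsto_const_nhds
  have hR : Tendsto (fun n : ℕ => ((n + 1 : ℕ) : ℝ≥0∞) * (1 - expNeg (c * (1 - expNeg (t n)))) * l)
      atTop (𝓝 (c * l)) := by
    refine ENNReal.Tendsto.mul_const ?_ (Or.inr (expNeg_ne_top _))
    refine tendsto_mul_one_sub_expNeg (fun n => ENNReal.mul_ne_top hctop ?_) hctop ?_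
    · exact (tsub_le_self.trans_lt ENNReal.one_lt_top).ne
    · simp_rw [mul_left_comm _ c]
      have : Tendsto (fun n : ℕ => ((n + 1 : ℕ) : ℝ≥0∞) * (1 - expNeg (t n))) atTop (𝓝 1) := by
        refine tendsto_mul_one_sub_expNeg httop ENNReal.one_ne_top ?_
        simp_rw [ht]
        exact tendsto_const_nhds
      simpa using ENNReal.Tendsto.const_mul this (Or.inr hctop)
  refine tendsto_nhds_unique hL ?_
  simp_rw [hid]
  exact hR

/-- The Campbell–Mecke formula for a weight `g` and a function `f` that does not depend on the
point. The inner sum still contains the point itself, whence the factor `e^{-f}` on the right. -/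
theorem IsHomogeneousPoisson.lintegral_tsum_mul_expNeg [IsProbabilityMeasure P]
    (h : IsHomogeneousPoisson P lam X) {f g : ℂ → ℝ≥0∞} (hf : Measurable f) (hg : Measurable g) :
    ∫⁻ ω, (∑' i, g (X i ω)) * expNeg (∑' j, f (X j ω)) ∂P =
      ENNReal.ofReal lam * (∫⁻ x, g x * expNeg (f x)) *
      expNeg (ENNReal.ofReal lam * ∫⁻ x, (1 - expNeg (f x))) := by
  set Z : Ω → ℝ≥0∞ := fun ω => expNeg (∑' j, f (X j ω)) with hZ
  set l := expNeg (ENNReal.ofReal lam * ∫⁻ x, (1 - expNeg (f x))) with hl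
  have hZm : Measurable Z := measurable_expNeg.comp (Measurable.tsum fun j => hf.comp (h.measurable j))
  have hfe : Measurable fun x => expNeg (f x) := measurable_expNeg.comp hf
  -- both sides are integrals of `g` against measures, which agree on sets of finite area
  let m₁ : Measure ℂ := Measure.sum fun i => (P.withDensity Z).map (X i)
  let m₂ : Measure ℂ := (ENNReal.ofReal lam * l) • volume.withDensity fun x => expNeg (f x)
  have h₁ : ∀ φ : ℂ → ℝ≥0∞, Measurable φ → ∫⁻ x, φ x ∂m₁ = ∫⁻ ω, (∑' i, φ (X i ω)) * Z ω ∂P := by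
    intro φ hφ
    have hm : ∀ i, Measurable fun ω => φ (X i ω) * Z ω := fun i =>
      (hφ.comp (h.measurable i)).mul hZm
    simp_rw [← ENNReal.tsum_mul_right]
    rw [lintegral_sum_measure, lintegral_tsum fun i => (hm i).aemeasurable]
    refine tsum_congr fun i => ?_
    have hφi : Measurable fun ω => φ (X i ω) := hφ.comp (h.measurable i)
    rw [lintegral_map hφ (h.measurable i), lintegral_withDensity_eq_lintegral_mul _ hZm hφi]
    simp [mul_comm]
  have h₂ : ∀ φ : ℂ → ℝ≥0∞, Measurable φ → ∫⁻ x, φ x ∂m₂ =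
      ENNReal.ofReal lam * (∫⁻ x, φ x * expNeg (f x)) * l := by
    intro φ hφ
    rw [lintegral_smul_measure, lintegral_withDensity_eq_lintegral_mul _ hfe hφ, smul_eq_mul,
      mul_right_comm]
    simp [mul_comm]
  have hfinite : ∀ B, MeasurableSet B → volume B ≠ ∞ → m₁ B = m₂ B := fun B hB hv => by
    rw [← lintegral_indicator_one hB, ← lintegral_indicator_one hB,
      h₁ _ (measurable_one.indicator hB), h₂ _ (measurable_one.indicator hB)]
    refine (h.lintegral_pointCount_mul_expNeg hf hB hv).trans ?_
    rw [← lintegral_indicator hB]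
    congr 4 with x
    by_cases hx : x ∈ B <;> simp [hx]
  have hm : m₁ = m₂ := by
    rw [Measure.ext_iff_of_iUnion_eq_univ (s := fun n : ℕ => Metric.ball (0 : ℂ) n)
      (Metric.iUnion_ball_nat 0)]
    intro n
    ext B hB
    rw [Measure.restrict_apply hB, Measure.restrict_apply hB]
    exact hfinite _ (hB.inter measurableSet_ball)
      ((measure_mono inter_subset_right).trans_lt measure_ball_lt_top).ne
  rw [← h₁ g hg, hm, h₂ g hg]

theorem add_tsum_ne (f : ℕ → ℝ≥0∞) (i : ℕ) : f i + ∑' j : {j // j ≠ i}, f j = ∑' j, f j := by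
  rw [← ENNReal.summable.tsum_add_tsum_compl (s := {i}) ENNReal.summable, tsum_singleton]
  rfl

/-- The reduced form of `lintegral_tsum_mul_expNeg`: the point itself is left out of the inner sum.
Finiteness of `f` makes it possible to divide by `e^{-f}`. -/
theorem IsHomogeneousPoisson.mecke_const [IsProbabilityMeasure P]
    (h : IsHomogeneousPoisson P lam X) {f g : ℂ → ℝ≥0∞} (hf : Measurable f) (hg : Measurable g)
    (hfin : ∀ x, f x ≠ ∞) :
    ∫⁻ ω, ∑' i, g (X i ω) * expNeg (∑' j : {j // j ≠ i}, f (X j ω)) ∂P =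
      ENNReal.ofReal lam * (∫⁻ x, g x) *
      expNeg (ENNReal.ofReal lam * ∫⁻ x, (1 - expNeg (f x))) := by
  have hfe : Measurable fun x => expNeg (f x) := measurable_expNeg.comp hf
  have hc : ∀ x, (expNeg (f x))⁻¹ * expNeg (f x) = 1 := fun x =>
    ENNReal.inv_mul_cancel (expNeg_ne_zero (hfin x)) (expNeg_ne_top _)
  have := h.lintegral_tsum_mul_expNeg hf (hg.mul hfe.inv)
  simp only [mul_assoc, hc, mul_one, Pi.mul_apply, Pi.inv_apply] at this
  rw [mul_assoc, ← this]
  congr 1 with ω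
  rw [← ENNReal.tsum_mul_right]
  refine tsum_congr fun i => ?_
  rw [← add_tsum_ne (fun j => f (X j ω)) i, expNeg_add, mul_assoc, ← mul_assoc _ (expNeg (f (X i ω))),
    hc, one_mul]

/-- The Campbell–Mecke formula for a parameter `s` with finitely many values: on each level set of
`s` the inner function is constant in the point. -/
theorem IsHomogeneousPoisson.mecke_simpleFunc [IsProbabilityMeasure P]
    (h : IsHomogeneousPoisson P lam X) {k : ℝ≥0∞ → ℂ → ℝ≥0∞} (hk : Measurable (Function.uncurry k))
    (hfin : ∀ s ≠ ∞, ∀ y, k s y ≠ ∞) (s : SimpleFunc ℂ ℝ≥0∞) (hs : ∀ x, s x ≠ ∞)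
    {g : ℂ → ℝ≥0∞} (hg : Measurable g) :
    ∫⁻ ω, ∑' i, g (X i ω) * expNeg (∑' j : {j // j ≠ i}, k (s (X i ω)) (X j ω)) ∂P =
      ENNReal.ofReal lam *
        ∫⁻ x, g x * expNeg (ENNReal.ofReal lam * ∫⁻ y, (1 - expNeg (k (s x) y))) := by
  have hkv : ∀ v, Measurable (k v) := fun v => hk.comp (measurable_const.prodMk measurable_id)
  have hsplit : ∀ (q : ℝ≥0∞ → ℝ≥0∞) (x : ℂ), g x * q (s x) =
      ∑ v ∈ s.range, (s ⁻¹' {v}).indicator g x * q v := fun q x => by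
    rw [Finset.sum_eq_single (s x)]
    · simp
    · intro b _ hb
      rw [indicator_of_notMem, zero_mul]
      simpa using hb.symm
    · intro hb
      exact absurd (s.mem_range_self _) hb
  have hgi : ∀ v, Measurable ((s ⁻¹' {v}).indicator g) := fun v =>
    hg.indicator (s.measurableSet_preimage _)
  have e1 : ∀ ω, ∑' i, g (X i ω) * expNeg (∑' j : {j // j ≠ i}, k (s (X i ω)) (X j ω)) =
      ∑ v ∈ s.range, ∑' i, (s ⁻¹' {v}).indicator g (X i ω) *
        expNeg (∑' j : {j // j ≠ i}, k v (X j ω)) := fun ω => by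
    rw [← Summable.tsum_finsetSum fun _ _ => ENNReal.summable]
    exact tsum_congr fun i => hsplit (fun v => expNeg (∑' j : {j // j ≠ i}, k v (X j ω))) (X i ω)
  have hmeas : ∀ v, Measurable fun ω => ∑' i, (s ⁻¹' {v}).indicator g (X i ω) *
      expNeg (∑' j : {j // j ≠ i}, k v (X j ω)) := fun v =>
    Measurable.tsum fun i => ((hgi v).comp (h.measurable i)).mul
      (measurable_expNeg.comp (Measurable.tsum fun j => (hkv v).comp (h.measurable j)))
  have hgm : ∀ v, Measurable fun x => (s ⁻¹' {v}).indicator g x *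
      expNeg (ENNReal.ofReal lam * ∫⁻ y, (1 - expNeg (k v y))) := fun v => (hgi v).mul_const _
  simp_rw [e1, hsplit (fun v => expNeg (ENNReal.ofReal lam * ∫⁻ y, (1 - expNeg (k v y))))]
  rw [lintegral_finsetSum _ fun v _ => hmeas v, lintegral_finsetSum _ fun v _ => hgm v, Finset.mul_sum]
  refine Finset.sum_congr rfl fun v hv => ?_
  obtain ⟨x, rfl⟩ := SimpleFunc.mem_range.1 hv
  rw [h.mecke_const (hkv _) (hgi _) (hfin _ (hs x)), lintegral_mul_const _ (hgi _), mul_assoc]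

theorem measurable_laplaceExponent {k : ℝ≥0∞ → ℂ → ℝ≥0∞} (hk : Measurable (Function.uncurry k)) :
    Measurable fun v => ∫⁻ y, (1 - expNeg (k v y)) :=
  Measurable.lintegral_prod_right' (f := fun p : ℝ≥0∞ × ℂ => 1 - expNeg (k p.1 p.2))
    (measurable_const.sub (measurable_expNeg.comp hk))

/-- The Campbell–Mecke formula for an integrable weight, which serves as dominating function when
`s` is approximated by simple functions. -/
theorem IsHomogeneousPoisson.mecke_of_integrable [IsProbabilityMeasure P]
    (h : IsHomogeneousPoisson P lam X) {k : ℝ≥0∞ → ℂ → ℝ≥0∞} (hk : Measurable (Function.uncurry k))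
    (hmono : ∀ y, Monotone fun v => k v y) (hcont : ∀ y, Continuous fun v => k v y)
    (hfin : ∀ s ≠ ∞, ∀ y, k s y ≠ ∞) {s : ℂ → ℝ≥0∞} (hs : Measurable s)
    {g : ℂ → ℝ≥0∞} (hg : Measurable g) (hgi : ∫⁻ x, g x ≠ ∞) :
    ∫⁻ ω, ∑' i, g (X i ω) * expNeg (∑' j : {j // j ≠ i}, k (s (X i ω)) (X j ω)) ∂P =
      ENNReal.ofReal lam *
        ∫⁻ x, g x * expNeg (ENNReal.ofReal lam * ∫⁻ y, (1 - expNeg (k (s x) y))) := by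
  let S : ℕ → SimpleFunc ℂ ℝ≥0∞ := SimpleFunc.eapprox s
  have hSm : ∀ x, Monotone fun n => S n x := fun x m n hmn => SimpleFunc.monotone_eapprox s hmn x
  have hSl : ∀ x, Tendsto (fun n => S n x) atTop (𝓝 (s x)) := SimpleFunc.tendsto_eapprox hs
  have hE := fun n => h.mecke_simpleFunc hk hfin (S n)
    (fun x => (SimpleFunc.eapprox_lt_top s n x).ne) hg
  have hgsum : ∫⁻ ω, ∑' i, g (X i ω) ∂P = ENNReal.ofReal lam * ∫⁻ x, g x := by
    have := h.mecke_const (f := fun _ => 0) measurable_const hg (by simp)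
    simpa [expNeg_zero] using this
  have hgtop : ∫⁻ ω, ∑' i, g (X i ω) ∂P ≠ ∞ := by
    rw [hgsum]; exact ENNReal.mul_ne_top ENNReal.ofReal_ne_top hgi
  have hgm : Measurable fun ω => ∑' i, g (X i ω) := Measurable.tsum fun i => hg.comp (h.measurable i)
  have hL : Tendsto (fun n => ∫⁻ ω, ∑' i, g (X i ω) *
      expNeg (∑' j : {j // j ≠ i}, k (S n (X i ω)) (X j ω)) ∂P) atTop
      (𝓝 (∫⁻ ω, ∑' i, g (X i ω) * expNeg (∑' j : {j // j ≠ i}, k (s (X i ω)) (X j ω)) ∂P)) := by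
    refine tendsto_lintegral_of_dominated_convergence (fun ω => ∑' i, g (X i ω)) (fun n => ?_)
      (fun n => ae_of_all _ fun ω => ENNReal.tsum_le_tsum fun i =>
        mul_le_of_le_one_right' (expNeg_le_one _)) hgtop ?_
    · exact Measurable.tsum fun i => (hg.comp (h.measurable i)).mul
        (measurable_expNeg.comp (Measurable.tsum fun j =>
          hk.comp (((S n).measurable.comp (h.measurable i)).prodMk (h.measurable j))))
    · filter_upwards [ae_lt_top hgm hgtop] with ω hω
      have hgω : ∀ i, g (X i ω) ≠ ∞ := fun i => ((ENNReal.le_tsum i).trans_lt hω).ne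
      simp_rw [← lintegral_count]
      refine tendsto_lintegral_of_dominated_convergence (fun i => g (X i ω))
        (fun n => measurable_of_countable _)
        (fun n => ae_of_all _ fun i => mul_le_of_le_one_right' (expNeg_le_one _))
        (by rw [lintegral_count]; exact hω.ne) (ae_of_all _ fun i => ?_)
      refine ENNReal.Tendsto.const_mul ?_ (Or.inr (hgω i))
      refine (continuous_expNeg.tendsto _).comp ?_
      exact lintegral_tendsto_of_tendsto_of_monotone
        (fun n => (measurable_of_countable _).aemeasurable)
        (ae_of_all _ fun j => (hmono (X j ω)).comp (hSm (X i ω)))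
        (ae_of_all _ fun j => ((hcont (X j ω)).tendsto _).comp (hSl (X i ω)))
  have hR : Tendsto (fun n => ENNReal.ofReal lam *
      ∫⁻ x, g x * expNeg (ENNReal.ofReal lam * ∫⁻ y, (1 - expNeg (k (S n x) y)))) atTop
      (𝓝 (ENNReal.ofReal lam *
        ∫⁻ x, g x * expNeg (ENNReal.ofReal lam * ∫⁻ y, (1 - expNeg (k (s x) y))))) := by
    refine ENNReal.Tendsto.const_mul ?_ (Or.inr ENNReal.ofReal_ne_top)
    refine tendsto_lintegral_of_dominated_convergence g (fun n => ?_)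
      (fun n => ae_of_all _ fun x => mul_le_of_le_one_right' (expNeg_le_one _)) hgi ?_
    · exact hg.mul (measurable_expNeg.comp (measurable_const.mul
        ((measurable_laplaceExponent hk).comp (S n).measurable)))
    · filter_upwards [ae_lt_top hg hgi] with x hx
      refine ENNReal.Tendsto.const_mul ?_ (Or.inr hx.ne)
      refine (continuous_expNeg.tendsto _).comp (ENNReal.Tendsto.const_mul ?_ (Or.inr ENNReal.ofReal_ne_top))
      refine lintegral_tendsto_of_tendsto_of_monotone (fun n => ?_)
        (ae_of_all _ fun y m n hmn => tsub_le_tsub_left (expNeg_antitone (hmono y (hSm x hmn))) _)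
        (ae_of_all _ fun y => ?_)
      · exact (measurable_const.sub (measurable_expNeg.comp
          (hk.comp (measurable_const.prodMk measurable_id)))).aemeasurable
      · exact ENNReal.Tendsto.sub tendsto_const_nhds
          (((continuous_expNeg.comp (hcont y)).tendsto _).comp (hSl x)) (Or.inl ENNReal.one_ne_top)
  refine tendsto_nhds_unique hL ?_
  simp_rw [hE]
  exact hR

/-- The Campbell–Mecke formula for `∑ i, g (X i) * exp (-∑ j ≠ i, k (s (X i)) (X j))`: seen from a
point of a Poisson process, the remaining points are again a Poisson process. The inner function may
depend on the point through a parameter `s`, in which it is monotone and continuous. -/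
theorem IsHomogeneousPoisson.mecke [IsProbabilityMeasure P]
    (h : IsHomogeneousPoisson P lam X) {k : ℝ≥0∞ → ℂ → ℝ≥0∞} (hk : Measurable (Function.uncurry k))
    (hmono : ∀ y, Monotone fun v => k v y) (hcont : ∀ y, Continuous fun v => k v y)
    (hfin : ∀ s ≠ ∞, ∀ y, k s y ≠ ∞) {s : ℂ → ℝ≥0∞} (hs : Measurable s)
    {g : ℂ → ℝ≥0∞} (hg : Measurable g) (hg1 : ∀ x, g x ≤ 1) :
    ∫⁻ ω, ∑' i, g (X i ω) * expNeg (∑' j : {j // j ≠ i}, k (s (X i ω)) (X j ω)) ∂P =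
      ENNReal.ofReal lam *
        ∫⁻ x, g x * expNeg (ENNReal.ofReal lam * ∫⁻ y, (1 - expNeg (k (s x) y))) := by
  let γ : ℕ → ℂ → ℝ≥0∞ := fun n => (Metric.ball (0 : ℂ) n).indicator g
  have hγm : ∀ n, Measurable (γ n) := fun n => hg.indicator measurableSet_ball
  have hγmono : ∀ x, Monotone fun n => γ n x := fun x m n hmn =>
    indicator_le_indicator_of_subset (Metric.ball_subset_ball (by exact_mod_cast hmn))
      (fun _ => bot_le) x
  have hγlim : ∀ x, Tendsto (fun n => γ n x) atTop (𝓝 (g x)) := fun x => by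
    refine tendsto_const_nhds.congr' ?_
    obtain ⟨N, hN⟩ := exists_nat_gt ‖x‖
    filter_upwards [eventually_ge_atTop N] with n hn
    refine (indicator_of_mem ?_ _).symm
    rw [mem_ball_zero_iff]
    exact hN.trans_le (by exact_mod_cast hn)
  have hγint : ∀ n, ∫⁻ x, γ n x ≠ ∞ := fun n => by
    refine ne_top_of_le_ne_top (measure_ball_lt_top (μ := (volume : Measure ℂ)) (x := 0) (r := n)).ne ?_
    rw [← lintegral_indicator_one measurableSet_ball]
    exact lintegral_mono fun x => indicator_le_indicator (hg1 x)
  have hE := fun n => h.mecke_of_integrable hk hmono hcont hfin hs (hγm n) (hγint n)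
  have hm : ∀ i, Measurable fun ω => expNeg (∑' j : {j // j ≠ i}, k (s (X i ω)) (X j ω)) := fun i =>
    measurable_expNeg.comp (Measurable.tsum fun j =>
      hk.comp ((hs.comp (h.measurable i)).prodMk (h.measurable j)))
  have hL : Tendsto (fun n => ∫⁻ ω, ∑' i, γ n (X i ω) *
      expNeg (∑' j : {j // j ≠ i}, k (s (X i ω)) (X j ω)) ∂P) atTop
      (𝓝 (∫⁻ ω, ∑' i, g (X i ω) * expNeg (∑' j : {j // j ≠ i}, k (s (X i ω)) (X j ω)) ∂P)) := by
    refine lintegral_tendsto_of_tendsto_of_monotone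
      (fun n => (Measurable.tsum fun i => ((hγm n).comp (h.measurable i)).mul (hm i)).aemeasurable)
      (ae_of_all _ fun ω m n hmn => ENNReal.tsum_le_tsum fun i => mul_le_mul_left (hγmono _ hmn) _)
      (ae_of_all _ fun ω => ?_)
    exact tendsto_tsum_of_monotone (fun i m n hmn => mul_le_mul_left (hγmono _ hmn) _)
      (fun i => ENNReal.Tendsto.mul_const (hγlim _) (Or.inr (expNeg_ne_top _)))
  have hR : Tendsto (fun n => ENNReal.ofReal lam *
      ∫⁻ x, γ n x * expNeg (ENNReal.ofReal lam * ∫⁻ y, (1 - expNeg (k (s x) y)))) atTop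
      (𝓝 (ENNReal.ofReal lam *
        ∫⁻ x, g x * expNeg (ENNReal.ofReal lam * ∫⁻ y, (1 - expNeg (k (s x) y))))) := by
    refine ENNReal.Tendsto.const_mul ?_ (Or.inr ENNReal.ofReal_ne_top)
    refine lintegral_tendsto_of_tendsto_of_monotone (fun n => ?_)
      (ae_of_all _ fun x m n hmn => mul_le_mul_left (hγmono _ hmn) _)
      (ae_of_all _ fun x => ENNReal.Tendsto.mul_const (hγlim _) (Or.inr (expNeg_ne_top _)))
    exact ((hγm n).mul (measurable_expNeg.comp (measurable_const.mul
        ((measurable_laplaceExponent hk).comp hs)))).aemeasurable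
  refine tendsto_nhds_unique hL ?_
  simp_rw [hE]
  exact hR

end PointProcess

/-! ### Independence -/

section Independence

variable {Ω : Type*} [MeasurableSpace Ω] {P : Measure Ω}

/-- Disjoint blocks of an independent family are independent. -/
theorem iIndepFun_curry {ι : Type*} {κ : ι → Type*} {E : Type*} [MeasurableSpace E]
    {f : (Σ i, κ i) → Ω → E} (hf : ∀ p, Measurable (f p)) (h : iIndepFun f P) :
    iIndepFun (fun i ω (j : κ i) => f ⟨i, j⟩ ω) P := by
  have := h.isProbabilityMeasure
  have hP : ∀ p, IsProbabilityMeasure (P.map (f p)) := fun p =>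
    Measure.isProbabilityMeasure_map (hf p).aemeasurable
  have hP' : ∀ i, IsProbabilityMeasure (P.map fun ω (j : κ i) => f ⟨i, j⟩ ω) := fun i =>
    Measure.isProbabilityMeasure_map (Measurable.aemeasurable (by fun_prop))
  have hi : ∀ i, P.map (fun ω (j : κ i) => f ⟨i, j⟩ ω) =
      Measure.infinitePi fun j => P.map (f ⟨i, j⟩) := fun i =>
    (iIndepFun_iff_map_fun_eq_infinitePi_map (by fun_prop)).1
      (h.precomp (g := fun j : κ i => (⟨i, j⟩ : Σ i, κ i)) sigma_mk_injective)
  rw [iIndepFun_iff_map_fun_eq_infinitePi_map (by fun_prop)]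
  simp_rw [hi]
  rw [← Measure.infinitePi_map_piCurry (fun i j => P.map (f ⟨i, j⟩)),
    ← (iIndepFun_iff_map_fun_eq_infinitePi_map hf).1 h,
    Measure.map_map (by fun_prop) (by fun_prop)]
  rfl

/-- A member of an independent family is independent of the family of all the others. -/
theorem indepFun_rest {ι : Type*} {E : Type*} [MeasurableSpace E]
    {f : ι → Ω → E} (hf : ∀ p, Measurable (f p)) (h : iIndepFun f P) (i : ι) :
    IndepFun (f i) (fun ω (j : {j // j ≠ i}) => f j ω) P := by
  classical
  have := h.isProbabilityMeasure
  refine IndepFun.indepFun_process (hf i) (fun j => hf j) fun I => ?_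
  have hd : Disjoint ({i} : Finset ι) (I.map (Function.Embedding.subtype _)) := by
    rw [Finset.disjoint_singleton_left]
    simp
  have h1 := h.indepFun_finset _ _ hd hf
  have h2 : Measurable fun z : (({i} : Finset ι) → E) => z ⟨i, Finset.mem_singleton_self i⟩ :=
    measurable_pi_apply _
  have h3 : Measurable fun (z : (I.map (Function.Embedding.subtype _) : Finset ι) → E) (j : I) =>
      z ⟨j.1.1, Finset.mem_map_of_mem _ j.2⟩ := measurable_pi_lambda _ fun _ => measurable_pi_apply _
  exact h1.comp h2 h3

theorem lintegral_expNeg_le_one {E : Type*} [MeasurableSpace E] (μ : Measure E)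
    [IsProbabilityMeasure μ] (f : E → ℝ≥0∞) : ∫⁻ x, expNeg (f x) ∂μ ≤ 1 :=
  calc ∫⁻ x, expNeg (f x) ∂μ ≤ ∫⁻ _, 1 ∂μ := lintegral_mono fun _ => expNeg_le_one _
    _ = 1 := by simp

/-- The Laplace transform of a sum of countably many independent terms. The infinite product of the
Laplace transforms is written as `expNeg` of a sum. -/
theorem lintegral_expNeg_tsum {Y : ℕ → Ω → ℝ≥0∞} (hY : ∀ j, Measurable (Y j))
    (h : iIndepFun Y P) :
    ∫⁻ ω, expNeg (∑' j, Y j ω) ∂P = expNeg (∑' j, negLog (∫⁻ ω, expNeg (Y j ω) ∂P)) := by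
  have := h.isProbabilityMeasure
  have hfin : ∀ n, ∫⁻ ω, expNeg (∑ j ∈ Finset.range n, Y j ω) ∂P =
      expNeg (∑ j ∈ Finset.range n, negLog (∫⁻ ω, expNeg (Y j ω) ∂P)) := fun n => by
    simp_rw [expNeg_finset_sum, expNeg_negLog (lintegral_expNeg_le_one P _)]
    exact lintegral_prod_eq_prod_lintegral_of_indepFun _ (fun j ω => expNeg (Y j ω))
      (h.comp (fun _ => expNeg) fun _ => measurable_expNeg) fun j => measurable_expNeg.comp (hY j)
  have hL : Tendsto (fun n => ∫⁻ ω, expNeg (∑ j ∈ Finset.range n, Y j ω) ∂P) atTop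
      (𝓝 (∫⁻ ω, expNeg (∑' j, Y j ω) ∂P)) := by
    refine tendsto_lintegral_of_dominated_convergence (fun _ => 1) (fun n => by fun_prop)
      (fun n => ae_of_all _ fun ω => expNeg_le_one _) (by simp) (ae_of_all _ fun ω => ?_)
    exact (continuous_expNeg.tendsto _).comp ENNReal.summable.tendsto_sum_tsum_nat
  refine tendsto_nhds_unique hL ?_
  simp_rw [hfin]
  exact (continuous_expNeg.tendsto _).comp ENNReal.summable.tendsto_sum_tsum_nat

/-- The tail of the exponential law. -/
theorem expMeasure_lt_ofReal (u : ℝ≥0∞) : expMeasure 1 {t | u < ENNReal.ofReal t} = expNeg u := by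
  have := isProbabilityMeasure_expMeasure one_pos
  rcases eq_or_ne u ∞ with rfl | hu
  · simp [expNeg_top]
  lift u to NNReal using hu
  have hu0 : 0 ≤ (u : ℝ) := u.2
  have e : {t : ℝ | (u : ℝ≥0∞) < ENNReal.ofReal t} = (Iic (u : ℝ))ᶜ := by
    ext t
    simp only [mem_ofPred_eq, compl_Iic, mem_Ioi]
    rw [← ENNReal.ofReal_coe_nnreal, ENNReal.ofReal_lt_ofReal_iff']
    exact ⟨fun h => h.1, fun h => ⟨h, hu0.trans_lt h⟩⟩
  have hI : expMeasure 1 (Iic (u : ℝ)) = ENNReal.ofReal (1 - Real.exp (-u)) := by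
    have := lintegral_exponentialPDF_eq_antiDeriv one_pos (u : ℝ)
    rw [if_pos hu0, one_mul] at this
    rw [← this, expMeasure, gammaMeasure, withDensity_apply _ measurableSet_Iic]
    rfl
  have hle : Real.exp (-(u : ℝ)) ≤ 1 := by rw [Real.exp_le_one_iff]; linarith
  rw [e, prob_compl_eq_one_sub measurableSet_Iic, hI, ← ENNReal.ofReal_coe_nnreal, expNeg_ofReal hu0,
    ← ENNReal.ofReal_one, ← ENNReal.ofReal_sub _ (by linarith)]
  congr 1; ring

end Independence

/-! ### The marks -/

/-- The joint law of the path loss exponent, the fading gain and the antenna gain of a link. -/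
def Params.markLaw (S : Params) : Measure (ℝ × ℝ × ℝ) :=
  S.exponentLaw.prod ((expMeasure 1).prod S.gainLaw)

/-- The power received from an interfering base station at `y` whose path loss exponent, fading
gain and antenna gain are the components of `q`. -/
def Params.power (S : Params) (y : ℂ) (q : ℝ × ℝ × ℝ) : ℝ≥0∞ :=
  ENNReal.ofReal (S.PT * q.2.2 * q.2.1 * ‖y‖ ^ (-q.1))

/-- The Laplace transform at `v` of the power received from an interfering base station at `y`. -/
def Params.powerLaplace (S : Params) (v : ℝ≥0∞) (y : ℂ) : ℝ≥0∞ :=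
  ∫⁻ q, expNeg (v * S.power y q) ∂S.markLaw

theorem Params.measurable_power (S : Params) :
    Measurable fun p : ℂ × (ℝ × ℝ × ℝ) => S.power p.1 p.2 := by
  unfold Params.power
  fun_prop

theorem Params.power_ne_top (S : Params) (y : ℂ) (q : ℝ × ℝ × ℝ) : S.power y q ≠ ∞ :=
  ENNReal.ofReal_ne_top

theorem Params.measurable_power_right (S : Params) (y : ℂ) : Measurable (S.power y) :=
  S.measurable_power.comp (measurable_const.prodMk measurable_id)

theorem Params.antitone_powerLaplace (S : Params) (y : ℂ) : Antitone fun v => S.powerLaplace v y :=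
  fun _ _ hvw => lintegral_mono fun _ => expNeg_antitone (mul_le_mul_left hvw _)

section PowerLaplace

variable (S : Params) [IsProbabilityMeasure S.markLaw]

theorem Params.measurable_powerLaplace : Measurable (Function.uncurry S.powerLaplace) := by
  have : Measurable fun z : (ℝ≥0∞ × ℂ) × (ℝ × ℝ × ℝ) => expNeg (z.1.1 * S.power z.1.2 z.2) :=
    measurable_expNeg.comp (measurable_fst.fst.mul
      (S.measurable_power.comp (measurable_fst.snd.prodMk measurable_snd)))
  exact this.lintegral_prod_right'

theorem Params.powerLaplace_le_one (v : ℝ≥0∞) (y : ℂ) : S.powerLaplace v y ≤ 1 :=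
  lintegral_expNeg_le_one _ _

theorem Params.powerLaplace_ne_zero {v : ℝ≥0∞} (hv : v ≠ ∞) (y : ℂ) : S.powerLaplace v y ≠ 0 := by
  have hm : Measurable fun q => expNeg (v * S.power y q) :=
    measurable_expNeg.comp ((S.measurable_power_right y).const_mul v)
  rw [Params.powerLaplace, Ne, lintegral_eq_zero_iff hm]
  intro h0
  obtain ⟨q, hq⟩ := h0.exists
  exact expNeg_ne_zero (ENNReal.mul_ne_top hv (S.power_ne_top y q)) hq

theorem Params.continuous_powerLaplace (y : ℂ) : Continuous fun v => S.powerLaplace v y := by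
  rw [continuous_iff_seqContinuous]
  intro v w hvw
  refine tendsto_lintegral_of_dominated_convergence (fun _ => 1) (fun n => ?_)
    (fun n => ae_of_all _ fun ω => expNeg_le_one _) (by simp) (ae_of_all _ fun q => ?_)
  · exact measurable_expNeg.comp ((S.measurable_power_right y).const_mul _)
  · exact (continuous_expNeg.tendsto _).comp
      (ENNReal.Tendsto.mul_const hvw (Or.inr (S.power_ne_top y q)))

/-- Minus the logarithm of `Params.powerLaplace`. -/
def Params.powerExponent (S : Params) (v : ℝ≥0∞) (y : ℂ) : ℝ≥0∞ := negLog (S.powerLaplace v y)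

theorem Params.expNeg_powerExponent (v : ℝ≥0∞) (y : ℂ) :
    expNeg (S.powerExponent v y) = S.powerLaplace v y :=
  expNeg_negLog (S.powerLaplace_le_one v y)

theorem Params.measurable_powerExponent : Measurable (Function.uncurry S.powerExponent) :=
  measurable_negLog.comp S.measurable_powerLaplace

end PowerLaplace

section Network

variable {Ω : Type*} [MeasurableSpace Ω] {P : Measure Ω} {S : Params}
  {M : ℕ} {X : ℕ → Ω → ℂ} {A : ℕ → Fin M → Ω → ℝ} {h G : ℕ → Ω → ℝ}

theorem IsNetwork.measurable_marks (hN : IsNetwork S P X A h G) (k) :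
    Measurable (marks A h G k) := by
  rcases k with q | j | j
  · exact hN.measurable_A _ _
  · exact hN.measurable_h j
  · exact hN.measurable_G j

theorem IsNetwork.isProbabilityMeasure_gainLaw [IsProbabilityMeasure P] (hN : IsNetwork S P X A h G) :
    IsProbabilityMeasure S.gainLaw :=
  (hN.law_G 0).isProbabilityMeasure_iff.1 inferInstance

variable [NeZero M]

/-- The path loss exponent, the fading gain and the antenna gain of the link of base station `j`,
when the base stations are located at `x`. -/
def linkMark (A : ℕ → Fin M → Ω → ℝ) (h G : ℕ → Ω → ℝ) (x : ℕ → ℂ) (j : ℕ) (ω : Ω) : ℝ × ℝ × ℝ :=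
  (A j (userSection M (x j)) ω, h j ω, G j ω)

theorem IsNetwork.measurable_linkMark (hN : IsNetwork S P X A h G) (x : ℕ → ℂ) (j : ℕ) :
    Measurable (linkMark A h G x j) :=
  (hN.measurable_A _ _).prodMk ((hN.measurable_h j).prodMk (hN.measurable_G j))

/-- At fixed locations, the link marks of distinct base stations involve disjoint sets of marks. -/
theorem IsNetwork.iIndepFun_linkMark (hN : IsNetwork S P X A h G) (x : ℕ → ℂ) :
    iIndepFun (linkMark A h G x) P := by
  let e : (Σ _ : ℕ, Fin 3) → (ℕ × Fin M) ⊕ (ℕ ⊕ ℕ) := fun p =>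
    ![Sum.inl (p.1, userSection M (x p.1)), Sum.inr (Sum.inl p.1), Sum.inr (Sum.inr p.1)] p.2
  have he : Function.Injective e := by
    rintro ⟨i, a⟩ ⟨j, b⟩ hab
    fin_cases a <;> fin_cases b <;> simp_all [e]
  have h1 := iIndepFun_curry (f := fun p => marks A h G (e p)) (fun p => hN.measurable_marks _)
    (hN.indep_marks.precomp he)
  exact h1.comp (fun _ z => (z 0, z 1, z 2)) fun _ => by fun_prop

variable [IsProbabilityMeasure P]

theorem IsNetwork.hasLaw_linkMark (hN : IsNetwork S P X A h G) (x : ℕ → ℂ) (j : ℕ) :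
    HasLaw (linkMark A h G x j) S.markLaw P where
  aemeasurable := (hN.measurable_linkMark x j).aemeasurable
  map_eq := by
    have h1 : IndepFun (h j) (G j) P :=
      hN.indep_marks.indepFun (i := Sum.inr (Sum.inl j)) (j := Sum.inr (Sum.inr j)) (by simp)
    have h2 : IndepFun (A j (userSection M (x j))) (fun ω => (h j ω, G j ω)) P :=
      (hN.indep_marks.indepFun_prodMk hN.measurable_marks (Sum.inr (Sum.inl j))
        (Sum.inr (Sum.inr j)) (Sum.inl (j, userSection M (x j))) (by simp) (by simp)).symm
    have e1 := (indepFun_iff_map_prod_eq_prod_map_map (hN.measurable_h j).aemeasurable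
      (hN.measurable_G j).aemeasurable).1 h1
    have e2 := (indepFun_iff_map_prod_eq_prod_map_map (hN.measurable_A j _).aemeasurable
      ((hN.measurable_h j).prodMk (hN.measurable_G j)).aemeasurable).1 h2
    rw [(hN.law_h j).map_eq, (hN.law_G j).map_eq] at e1
    rw [(hN.law_A j _).map_eq, e1] at e2
    exact e2

theorem IsNetwork.isProbabilityMeasure_markLaw (hN : IsNetwork S P X A h G) :
    IsProbabilityMeasure S.markLaw :=
  (hN.hasLaw_linkMark (fun _ => 0) 0).isProbabilityMeasure_iff.1 inferInstance

theorem IsNetwork.isProbabilityMeasure_exponentLaw (hN : IsNetwork S P X A h G) :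
    IsProbabilityMeasure S.exponentLaw :=
  (hN.law_A 0 0).isProbabilityMeasure_iff.1 inferInstance

/-- The Laplace transform of the interference when the base stations are at fixed locations `x`. -/
theorem IsNetwork.lintegral_expNeg_interference (hN : IsNetwork S P X A h G) (x : ℕ → ℂ) (i : ℕ)
    (v : ℝ≥0∞) :
    ∫⁻ ω, expNeg (v * ∑' j : {j // j ≠ i}, S.power (x j) (linkMark A h G x j ω)) ∂P =
      expNeg (∑' j : {j // j ≠ i}, S.powerExponent v (x j)) := by
  classical
  -- the serving station contributes `0`, which turns the sum over `j ≠ i` into a sum over `ℕ`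
  let φ : ℕ → (ℝ × ℝ × ℝ) → ℝ≥0∞ := fun j q => if j = i then 0 else v * S.power (x j) q
  have hφ : ∀ j, Measurable (φ j) := fun j => by
    by_cases hj : j = i
    · simp only [φ, hj, if_true]; exact measurable_const
    · simp only [φ, hj, if_false]; exact (S.measurable_power_right _).const_mul v
  have hsum : ∀ f : ℕ → ℝ≥0∞, ∑' j : {j // j ≠ i}, f j = ∑' j, if j = i then 0 else f j := fun f => by
    refine (tsum_subtype {j | j ≠ i} f).trans (tsum_congr fun j => ?_)
    by_cases hj : j = i <;> simp [indicator, hj]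
  have hind := (hN.iIndepFun_linkMark x).comp φ hφ
  have key := lintegral_expNeg_tsum (fun j => (hφ j).comp (hN.measurable_linkMark x j)) hind
  simp_rw [← ENNReal.tsum_mul_left]
  rw [hsum (fun j => S.powerExponent v (x j))]
  have hsum' : ∀ ω, ∑' j : {j // j ≠ i}, v * S.power (x j) (linkMark A h G x j ω) =
      ∑' j, φ j (linkMark A h G x j ω) := fun ω =>
    hsum fun j => v * S.power (x j) (linkMark A h G x j ω)
  simp_rw [hsum']
  refine key.trans ?_
  congr 2 with j
  by_cases hj : j = i
  · simp [φ, hj, expNeg_zero, negLog]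
  · rw [if_neg hj]
    simp only [Function.comp, φ, if_neg hj, Params.powerExponent, Params.powerLaplace]
    rw [(hN.hasLaw_linkMark x j).lintegral_comp (f := fun q => expNeg (v * S.power (x j) q))]
    exact (measurable_expNeg.comp ((S.measurable_power_right _).const_mul v)).aemeasurable

/-- For base stations at fixed locations `x`, the probability that the fading gain of base station
`i` exceeds a multiple of interference plus noise which depends on its path loss exponent. -/
theorem IsNetwork.measure_lt_fading (hN : IsNetwork S P X A h G) (x : ℕ → ℂ) (i : ℕ)
    {v : ℝ → ℝ≥0∞} (hv : Measurable v) (N : ℝ≥0∞) :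
    P {ω | v (linkMark A h G x i ω).1 *
        (∑' j : {j // j ≠ i}, S.power (x j) (linkMark A h G x j ω) + N) <
          ENNReal.ofReal (h i ω)} =
      ∫⁻ a, expNeg (v a * N) * expNeg (∑' j : {j // j ≠ i}, S.powerExponent (v a) (x j))
        ∂S.exponentLaw := by
  have := hN.isProbabilityMeasure_exponentLaw
  have := hN.isProbabilityMeasure_gainLaw
  have := isProbabilityMeasure_expMeasure one_pos
  set I : Ω → ℝ≥0∞ := fun ω => ∑' j : {j // j ≠ i}, S.power (x j) (linkMark A h G x j ω) with hI
  have hIm : Measurable I := Measurable.tsum fun j =>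
    (S.measurable_power_right _).comp (hN.measurable_linkMark x j)
  have hind : IndepFun I (linkMark A h G x i) P := by
    have h1 := indepFun_rest (hN.measurable_linkMark x) (hN.iIndepFun_linkMark x) i
    have h2 : Measurable fun z : {j // j ≠ i} → ℝ × ℝ × ℝ =>
        ∑' j : {j // j ≠ i}, S.power (x j) (z j) :=
      Measurable.tsum fun j => (S.measurable_power_right _).comp (measurable_pi_apply j)
    exact (h1.comp measurable_id h2).symm
  have hmap := (indepFun_iff_map_prod_eq_prod_map_map hIm.aemeasurable
    (hN.measurable_linkMark x i).aemeasurable).1 hind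
  rw [(hN.hasLaw_linkMark x i).map_eq] at hmap
  let E : Set (ℝ≥0∞ × (ℝ × ℝ × ℝ)) := {z | v z.2.1 * (z.1 + N) < ENNReal.ofReal z.2.2.1}
  have hE : MeasurableSet E := measurableSet_lt
    ((hv.comp measurable_snd.fst).mul (measurable_fst.add_const N))
    (ENNReal.measurable_ofReal.comp measurable_snd.snd.fst)
  have e1 : P {ω | v (linkMark A h G x i ω).1 * (I ω + N) < ENNReal.ofReal (h i ω)} =
      (P.map fun ω => (I ω, linkMark A h G x i ω)) E :=
    (Measure.map_apply (hIm.prodMk (hN.measurable_linkMark x i)) hE).symm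
  have e2 : ∀ u : ℝ≥0∞, S.markLaw (Prod.mk u ⁻¹' E) =
      ∫⁻ a, expNeg (v a * (u + N)) ∂S.exponentLaw := fun u => by
    rw [Params.markLaw, Measure.prod_apply (measurable_prodMk_left hE)]
    refine lintegral_congr fun a => ?_
    have : Prod.mk a ⁻¹' (Prod.mk u ⁻¹' E) =
        {t : ℝ | v a * (u + N) < ENNReal.ofReal t} ×ˢ univ := by
      ext z; simp [E]
    rw [this, Measure.prod_prod, expMeasure_lt_ofReal, measure_univ, mul_one]
  have := hN.isProbabilityMeasure_markLaw
  have hm2 : Measurable fun z : Ω × ℝ => expNeg (v z.2 * (I z.1 + N)) :=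
    measurable_expNeg.comp ((hv.comp measurable_snd).mul ((hIm.comp measurable_fst).add_const N))
  rw [e1, hmap, Measure.prod_apply hE]
  simp_rw [e2]
  have hm1 : Measurable fun u : ℝ≥0∞ => ∫⁻ a, expNeg (v a * (u + N)) ∂S.exponentLaw := by
    have : Measurable fun z : ℝ≥0∞ × ℝ => expNeg (v z.2 * (z.1 + N)) :=
      measurable_expNeg.comp ((hv.comp measurable_snd).mul (measurable_fst.add_const N))
    exact this.lintegral_prod_right'
  rw [lintegral_map hm1 hIm, lintegral_lintegral_swap hm2.aemeasurable]
  refine lintegral_congr fun a => ?_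
  have e3 : ∀ ω, expNeg (v a * (I ω + N)) = expNeg (v a * N) * expNeg (v a * I ω) := fun ω => by
    rw [mul_add, expNeg_add, mul_comm]
  simp_rw [e3]
  have hm3 : Measurable fun ω => expNeg (v a * I ω) := measurable_expNeg.comp (hIm.const_mul _)
  rw [lintegral_const_mul _ hm3, hN.lintegral_expNeg_interference]

end Network

/-! ### The exponent of the Laplace functional of the interference -/

theorem lintegral_expMeasure {f : ℝ → ℝ≥0∞} (hf : Measurable f) :
    ∫⁻ t, f t ∂expMeasure 1 = ∫⁻ t in Ioi 0, ENNReal.ofReal (Real.exp (-t)) * f t := by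
  have hm : Measurable (gammaPDF 1 1) := (measurable_gammaPDFReal 1 1).ennreal_ofReal
  rw [expMeasure, gammaMeasure, lintegral_withDensity_eq_lintegral_mul _ hm hf,
    setLIntegral_congr Ioi_ae_eq_Ici, ← lintegral_indicator measurableSet_Ici]
  refine lintegral_congr fun t => ?_
  have h1 : gammaPDF 1 1 t = exponentialPDF 1 t := rfl
  simp only [Pi.mul_apply, h1, exponentialPDF_eq, one_mul]
  by_cases ht : 0 ≤ t <;> simp [ht]

/-- The moments of the exponential law, also of negative order above `-1`. -/
theorem lintegral_rpow_expMeasure {s : ℝ} (hs : -1 < s) :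
    ∫⁻ t, ENNReal.ofReal (t ^ s) ∂expMeasure 1 = ENNReal.ofReal (Real.Gamma (s + 1)) := by
  have hs' : 0 < s + 1 := by linarith
  rw [lintegral_expMeasure (by fun_prop), Real.Gamma_eq_integral hs',
    ofReal_integral_eq_lintegral_ofReal (Real.GammaIntegral_convergent hs')]
  · refine setLIntegral_congr_fun measurableSet_Ioi fun t ht => ?_
    simp only [add_sub_cancel_right]
    rw [ENNReal.ofReal_mul (Real.exp_nonneg _)]
  · filter_upwards [ae_restrict_mem measurableSet_Ioi] with t ht
    exact mul_nonneg (Real.exp_nonneg _) (Real.rpow_nonneg (le_of_lt ht) _)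

theorem ae_pos_expMeasure : ∀ᵐ t ∂expMeasure 1, 0 < t := by
  have := isProbabilityMeasure_expMeasure one_pos
  have h := expMeasure_lt_ofReal 0
  simp only [ENNReal.ofReal_pos, expNeg_zero] at h
  exact mem_ae_iff_prob_eq_one (measurableSet_lt measurable_const measurable_id) |>.2 h

/-- The area of the region in which a path loss exceeds a threshold. It is a punctured disc, because
`0 ^ (-α) = 0` in Lean. -/
theorem volume_le_pathLoss {α C t : ℝ} (hα : 0 < α) (hC : 0 < C) (ht : 0 < t) :
    volume {y : ℂ | ENNReal.ofReal t ≤ ENNReal.ofReal (C * ‖y‖ ^ (-α))} =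
      ENNReal.ofReal (Real.pi * (C / t) ^ (2 / α)) := by
  have e : {y : ℂ | ENNReal.ofReal t ≤ ENNReal.ofReal (C * ‖y‖ ^ (-α))} =
      Metric.closedBall 0 ((C / t) ^ (1 / α)) \ {0} := by
    ext y
    simp only [mem_ofPred_eq, Set.mem_sdiff, mem_closedBall_zero_iff, mem_singleton_iff]
    rcases eq_or_ne y 0 with rfl | hy
    · simp [Real.zero_rpow (neg_ne_zero.2 hα.ne'), ht]
    have hy' : 0 < ‖y‖ := norm_pos_iff.2 hy
    have hyα : 0 < ‖y‖ ^ α := Real.rpow_pos_of_pos hy' _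
    rw [ENNReal.ofReal_le_ofReal_iff (by positivity), Real.rpow_neg hy'.le, ← div_eq_mul_inv,
      le_div_iff₀ hyα, one_div, Real.le_rpow_inv_iff_of_pos hy'.le (by positivity) hα,
      le_div_iff₀ ht, mul_comm]
    simp [hy]
  rw [e, measure_sdiff_null (by simp), Complex.volume_closedBall]
  have h0 : 0 ≤ (C / t) ^ (1 / α) := by positivity
  rw [← ENNReal.ofReal_pow h0, ← Real.rpow_natCast, ← Real.rpow_mul (by positivity), mul_comm Real.pi,
    ENNReal.ofReal_mul (by positivity)]
  congr 1
  · congr 2; push_cast; ring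
  · rw [← ENNReal.ofReal_coe_nnreal]; rfl

/-- The mean area of a disc whose squared radius is `(K h / t) ^ z` with `h` and `t` independent
exponential variables. The moments `Γ(1 + z)` and `Γ(1 - z)` combine by the reflection formula;
this is where the cosecant comes from. -/
theorem lintegral_fading_ratio {z K : ℝ} (hz0 : 0 < z) (hz1 : z < 1) (hK : 0 < K) :
    ∫⁻ h, ∫⁻ t, ENNReal.ofReal (Real.pi * (K * h / t) ^ z) ∂expMeasure 1 ∂expMeasure 1 =
      ENNReal.ofReal (Real.pi * K ^ z * (Real.pi * z / Real.sin (Real.pi * z))) := by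
  have hpi := Real.pi_pos
  have hG1 : 0 < Real.Gamma (-z + 1) := Real.Gamma_pos_of_pos (by linarith)
  have h1 : ∀ h, 0 < h → ∫⁻ t, ENNReal.ofReal (Real.pi * (K * h / t) ^ z) ∂expMeasure 1 =
      ENNReal.ofReal (Real.pi * K ^ z * Real.Gamma (-z + 1)) * ENNReal.ofReal (h ^ z) := by
    intro h hh
    have : ∀ᵐ t ∂expMeasure 1, ENNReal.ofReal (Real.pi * (K * h / t) ^ z) =
        ENNReal.ofReal (Real.pi * K ^ z * h ^ z) * ENNReal.ofReal (t ^ (-z)) := by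
      filter_upwards [ae_pos_expMeasure] with t ht
      rw [← ENNReal.ofReal_mul (by positivity), Real.div_rpow (by positivity) ht.le,
        Real.mul_rpow hK.le hh.le, Real.rpow_neg ht.le]
      congr 1
      ring
    rw [lintegral_congr_ae this, lintegral_const_mul _ (by fun_prop),
      lintegral_rpow_expMeasure (by linarith), ← ENNReal.ofReal_mul (by positivity),
      ← ENNReal.ofReal_mul (by positivity)]
    congr 1
    ring
  have h2 : ∀ᵐ h ∂expMeasure 1, ∫⁻ t, ENNReal.ofReal (Real.pi * (K * h / t) ^ z) ∂expMeasure 1 =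
      ENNReal.ofReal (Real.pi * K ^ z * Real.Gamma (-z + 1)) * ENNReal.ofReal (h ^ z) := by
    filter_upwards [ae_pos_expMeasure] with h hh using h1 h hh
  rw [lintegral_congr_ae h2, lintegral_const_mul _ (by fun_prop),
    lintegral_rpow_expMeasure (by linarith), ← ENNReal.ofReal_mul (by positivity)]
  congr 1
  have h3 := Real.Gamma_mul_Gamma_one_sub z
  rw [Real.Gamma_add_one hz0.ne', neg_add_eq_sub]
  calc Real.pi * K ^ z * Real.Gamma (1 - z) * (z * Real.Gamma z)
      = Real.pi * K ^ z * z * (Real.Gamma z * Real.Gamma (1 - z)) := by ring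
    _ = _ := by rw [h3]; ring

theorem lintegral_gainLaw (S : Params) {f : ℝ → ℝ≥0∞} :
    ∫⁻ g, f g ∂S.gainLaw = ∑ l, ENNReal.ofReal (S.prob l) * f (S.gain l) := by
  rw [Params.gainLaw, lintegral_finsetSum_measure]
  simp [lintegral_smul_measure]

section Admissible

variable {S : Params}

theorem Params.Admissible.Mt_pos (hS : S.Admissible) : 0 < S.Mt := hS.mt_pos.trans_le hS.mt_le

theorem Params.Admissible.Mr_pos (hS : S.Admissible) : 0 < S.Mr := hS.mr_pos.trans_le hS.mr_le

theorem Params.Admissible.gain_pos (hS : S.Admissible) (l : Fin 4) : 0 < S.gain l := by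
  have := hS.Mt_pos
  have := hS.Mr_pos
  have := hS.mt_pos
  have := hS.mr_pos
  fin_cases l <;> simp [Params.gain] <;> positivity

theorem Params.Admissible.gain_ge (hS : S.Admissible) (l : Fin 4) : S.mt * S.mr ≤ S.gain l := by
  have := hS.Mt_pos
  have := hS.Mr_pos
  have := hS.mt_pos
  have := hS.mr_pos
  have := hS.mt_le
  have := hS.mr_le
  fin_cases l <;> simp [Params.gain] <;> gcongr

theorem Params.Admissible.prob_nonneg (hS : S.Admissible) (l : Fin 4) : 0 ≤ S.prob l := by
  have hpi := Real.two_pi_pos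
  have h1 : 0 ≤ S.φt / (2 * Real.pi) := div_nonneg hS.φt_nonneg hpi.le
  have h2 : 0 ≤ S.φr / (2 * Real.pi) := div_nonneg hS.φr_nonneg hpi.le
  have h3 : 0 ≤ 1 - S.φt / (2 * Real.pi) := sub_nonneg.2 ((div_le_one hpi).2 hS.φt_le)
  have h4 : 0 ≤ 1 - S.φr / (2 * Real.pi) := sub_nonneg.2 ((div_le_one hpi).2 hS.φr_le)
  fin_cases l <;> simp only [Params.prob] <;> simp <;> positivity

theorem Params.Admissible.spread_pos (hS : S.Admissible) : 0 < √3 * S.σ :=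
  mul_pos (by positivity) hS.σ_pos

theorem Params.Admissible.lintegral_exponentLaw (hS : S.Admissible) (f : ℝ → ℝ≥0∞) :
    ∫⁻ a, f a ∂S.exponentLaw = ENNReal.ofReal (1 / (2 * (√3 * S.σ))) *
      ∫⁻ a in Icc (S.μ - √3 * S.σ) (S.μ + √3 * S.σ), f a := by
  have hs := hS.spread_pos
  rw [Params.exponentLaw, ProbabilityTheory.cond, lintegral_smul_measure, Real.volume_Icc,
    smul_eq_mul, ← ENNReal.ofReal_inv_of_pos (by linarith)]
  congr 2
  rw [one_div]; congr 1; ring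

theorem Params.ae_exponentLaw (S : Params) :
    ∀ᵐ a ∂S.exponentLaw, a ∈ Icc (S.μ - √3 * S.σ) (S.μ + √3 * S.σ) :=
  (ae_restrict_mem measurableSet_Icc).filter_mono
    (Measure.smul_absolutelyContinuous).ae_le

/-- The integral in the Laplace functional of the interference. Writing `1 - e^{-w}` as the
probability that an exponential variable is at most `w` and integrating over the location first
gives mean areas of discs. -/
theorem Params.Admissible.lintegral_one_sub_powerLaplace (hS : S.Admissible)
    [IsProbabilityMeasure S.markLaw] [IsProbabilityMeasure S.exponentLaw]
    [IsProbabilityMeasure S.gainLaw] {c : ℝ} (hc : 0 < c) :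
    ∫⁻ y, (1 - S.powerLaplace (ENNReal.ofReal c) y) =
      ∫⁻ α, ∑ l, ENNReal.ofReal (S.prob l) * ENNReal.ofReal (Real.pi * (c * S.PT * S.gain l) ^ (2 / α) *
        (Real.pi * (2 / α) / Real.sin (Real.pi * (2 / α)))) ∂S.exponentLaw := by
  have := isProbabilityMeasure_expMeasure one_pos
  let E : Set (ℂ × ((ℝ × ℝ × ℝ) × ℝ)) :=
    {z | ENNReal.ofReal z.2.2 ≤ ENNReal.ofReal c * S.power z.1 z.2.1}
  have hE : MeasurableSet E := measurableSet_le
    (ENNReal.measurable_ofReal.comp measurable_snd.snd)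
    ((S.measurable_power.comp (measurable_fst.prodMk measurable_snd.fst)).const_mul _)
  -- `1 - e^{-w}` is the probability that an exponential variable is at most `w`
  have h1 : ∀ y, 1 - S.powerLaplace (ENNReal.ofReal c) y =
      (S.markLaw.prod (expMeasure 1)) (Prod.mk y ⁻¹' E) := fun y => by
    have hm : Measurable fun q => expNeg (ENNReal.ofReal c * S.power y q) :=
      measurable_expNeg.comp ((S.measurable_power_right y).const_mul _)
    rw [Measure.prod_apply (measurable_prodMk_left hE), Params.powerLaplace,
      show (1 : ℝ≥0∞) = ∫⁻ _, 1 ∂S.markLaw by simp, ← lintegral_sub hm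
        (ne_top_of_le_ne_top ENNReal.one_ne_top (lintegral_expNeg_le_one _ _))
        (ae_of_all _ fun _ => expNeg_le_one _)]
    refine lintegral_congr fun q => ?_
    rw [← expMeasure_lt_ofReal, ← prob_compl_eq_one_sub
      (measurableSet_lt measurable_const ENNReal.measurable_ofReal)]
    congr 1
    ext t
    simp [E]
  have hvm : Measurable fun z : (ℝ × ℝ × ℝ) × ℝ => volume ((fun y : ℂ => (y, z)) ⁻¹' E) :=
    measurable_measure_prodMk_right hE
  have h2 : ∀ α h g t : ℝ, 0 < α → 0 < h → 0 < g → 0 < t →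
      volume ((fun y : ℂ => (y, ((α, h, g), t))) ⁻¹' E) =
        ENNReal.ofReal (Real.pi * (c * S.PT * g * h / t) ^ (2 / α)) := by
    intro α h g t hα hh hg ht
    have hP := hS.PT_pos
    rw [← volume_le_pathLoss hα (C := c * S.PT * g * h) (by positivity) ht]
    congr 1
    ext y
    simp only [E, mem_preimage, mem_ofPred_eq, Params.power]
    rw [← ENNReal.ofReal_mul hc.le]
    ring_nf
  simp_rw [h1]
  rw [← Measure.prod_apply hE, Measure.prod_apply_symm hE, lintegral_prod _ hvm.aemeasurable]
  have hvm1 : Measurable fun q => ∫⁻ t, volume ((fun y : ℂ => (y, (q, t))) ⁻¹' E) ∂expMeasure 1 :=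
    hvm.lintegral_prod_right'
  rw [Params.markLaw, lintegral_prod _ hvm1.aemeasurable]
  refine lintegral_congr_ae ?_
  filter_upwards [S.ae_exponentLaw] with α hα
  have h2α : 2 < α := hS.two_lt.trans_le hα.1
  have hz0 : 0 < 2 / α := by positivity
  have hz1 : 2 / α < 1 := by rw [div_lt_one (by linarith)]; exact h2α
  have hvm2 : Measurable fun q : ℝ × ℝ =>
      ∫⁻ t, volume ((fun y : ℂ => (y, ((α, q), t))) ⁻¹' E) ∂expMeasure 1 :=
    hvm1.comp (measurable_const.prodMk measurable_id)
  rw [lintegral_prod _ hvm2.aemeasurable]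
  simp_rw [lintegral_gainLaw]
  rw [lintegral_finsetSum]
  · refine Finset.sum_congr rfl fun l _ => ?_
    rw [lintegral_const_mul]
    · congr 1
      have hg := hS.gain_pos l
      have hP := hS.PT_pos
      rw [← lintegral_fading_ratio hz0 hz1 (K := c * S.PT * S.gain l) (by positivity)]
      refine lintegral_congr_ae ?_
      filter_upwards [ae_pos_expMeasure] with h hh
      refine lintegral_congr_ae ?_
      filter_upwards [ae_pos_expMeasure] with t ht
      exact h2 α h _ t (by linarith) hh hg ht
    · exact hvm2.comp (measurable_id.prodMk measurable_const)
  · intro l _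
    exact (hvm2.comp (measurable_id.prodMk measurable_const)).const_mul _

end Admissible

/-! ### The innermost integral -/

section Inner

variable {S : Params}

theorem Params.Admissible.threshold_pos (hS : S.Admissible) {τ : ℝ}
    (hτ : S.Mt * S.Mr / (S.mt * S.mr) < τ) : 0 < τ :=
  (div_pos (mul_pos hS.Mt_pos hS.Mr_pos) (mul_pos hS.mt_pos hS.mr_pos)).trans hτ

theorem Params.Admissible.innerIntegrand_nonneg (hS : S.Admissible) {τ r a α : ℝ} (hτ : 0 < τ)
    (hr : 0 < r) (l : Fin 4) (hα : α ∈ Icc (S.μ - √3 * S.σ) (S.μ + √3 * S.σ)) :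
    0 ≤ S.innerIntegrand τ r a l α := by
  have h2α : 2 < α := hS.two_lt.trans_le hα.1
  have := hS.gain_pos l
  have := hS.Mt_pos
  have := hS.Mr_pos
  have hsin : 0 < Real.sin (2 * Real.pi / α) := by
    apply Real.sin_pos_of_pos_of_lt_pi
    · have := Real.pi_pos; positivity
    · rw [div_lt_iff₀ (by linarith), mul_comm]
      exact mul_lt_mul_of_pos_left h2α Real.pi_pos
  unfold Params.innerIntegrand
  positivity

theorem Params.Admissible.intervalIntegrable_innerIntegrand (hS : S.Admissible) {τ r : ℝ} (hτ : 0 < τ)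
    (hr : 0 < r) (a : ℝ) (l : Fin 4) :
    IntervalIntegrable (S.innerIntegrand τ r a l) volume (S.μ - √3 * S.σ) (S.μ + √3 * S.σ) := by
  have hs := hS.spread_pos
  refine ContinuousOn.intervalIntegrable ?_
  rw [uIcc_of_le (by linarith)]
  have hbase : 0 < τ * r ^ a * S.gain l / (S.Mt * S.Mr) := by
    have := hS.gain_pos l
    have := hS.Mt_pos
    have := hS.Mr_pos
    positivity
  have hne : ∀ α ∈ Icc (S.μ - √3 * S.σ) (S.μ + √3 * S.σ), α ≠ 0 := fun α hα => by
    have : 2 < α := hS.two_lt.trans_le hα.1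
    linarith
  have hsin : ∀ α ∈ Icc (S.μ - √3 * S.σ) (S.μ + √3 * S.σ), Real.sin (2 * Real.pi / α) ≠ 0 :=
    fun α hα => by
      have h2α : 2 < α := hS.two_lt.trans_le hα.1
      refine (Real.sin_pos_of_pos_of_lt_pi ?_ ?_).ne'
      · have := Real.pi_pos; positivity
      · rw [div_lt_iff₀ (by linarith), mul_comm]
        exact mul_lt_mul_of_pos_left h2α Real.pi_pos
  unfold Params.innerIntegrand
  refine ContinuousOn.mul (ContinuousOn.div (ContinuousOn.rpow continuousOn_const
    (continuousOn_const.div continuousOn_id hne) fun _ _ => Or.inl hbase.ne') continuousOn_id hne)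
    (continuousOn_const.div ?_ hsin)
  exact Real.continuous_sin.comp_continuousOn (continuousOn_const.div continuousOn_id hne)

/-- The Laplace exponent of the interference at the threshold of a serving link of length `r` and
path loss exponent `a`. -/
theorem Params.Admissible.laplaceExponent_eq (hS : S.Admissible)
    [IsProbabilityMeasure S.markLaw] [IsProbabilityMeasure S.exponentLaw]
    [IsProbabilityMeasure S.gainLaw] {τ r : ℝ} (hτ : 0 < τ) (hr : 0 < r) (a : ℝ) :
    ENNReal.ofReal S.lam *
      ∫⁻ y, (1 - S.powerLaplace (ENNReal.ofReal (τ * r ^ a / (S.PT * (S.Mt * S.Mr)))) y) =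
      ENNReal.ofReal (S.lam * Real.pi ^ 2 / (√3 * S.σ) * ∑ l, S.prob l *
        ∫ α in (S.μ - √3 * S.σ)..(S.μ + √3 * S.σ), S.innerIntegrand τ r a l α) := by
  have hs := hS.spread_pos
  have hMt := hS.Mt_pos
  have hMr := hS.Mr_pos
  have hP := hS.PT_pos
  have hpi := Real.pi_pos
  have hlam := hS.lam_pos
  rw [hS.lintegral_one_sub_powerLaplace (by positivity), hS.lintegral_exponentLaw]
  have e : ∀ l α, ENNReal.ofReal (Real.pi * (τ * r ^ a / (S.PT * (S.Mt * S.Mr)) * S.PT * S.gain l) ^ (2 / α) *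
        (Real.pi * (2 / α) / Real.sin (Real.pi * (2 / α)))) =
      ENNReal.ofReal (2 * Real.pi ^ 2) * ENNReal.ofReal (S.innerIntegrand τ r a l α) := by
    intro l α
    rw [← ENNReal.ofReal_mul (by positivity), Params.innerIntegrand]
    congr 1
    rw [show τ * r ^ a / (S.PT * (S.Mt * S.Mr)) * S.PT * S.gain l =
      τ * r ^ a * S.gain l / (S.Mt * S.Mr) by field_simp,
      show Real.pi * (2 / α) = 2 * Real.pi / α by ring]
    ring
  simp_rw [e]
  have hint := fun l => hS.intervalIntegrable_innerIntegrand hτ hr a l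
  have hle : S.μ - √3 * S.σ ≤ S.μ + √3 * S.σ := by linarith
  have hintI : ∀ l, IntegrableOn (S.innerIntegrand τ r a l)
      (Icc (S.μ - √3 * S.σ) (S.μ + √3 * S.σ)) := fun l =>
    (intervalIntegrable_iff_integrableOn_Icc_of_le hle).1 (hint l)
  have hI : ∀ l, ∫⁻ α in Icc (S.μ - √3 * S.σ) (S.μ + √3 * S.σ),
      ENNReal.ofReal (S.innerIntegrand τ r a l α) =
      ENNReal.ofReal (∫ α in (S.μ - √3 * S.σ)..(S.μ + √3 * S.σ), S.innerIntegrand τ r a l α) := fun l => by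
    rw [intervalIntegral.integral_of_le hle, ← integral_Icc_eq_integral_Ioc,
      ofReal_integral_eq_lintegral_ofReal (hintI l)]
    filter_upwards [ae_restrict_mem measurableSet_Icc] with α hα
    exact hS.innerIntegrand_nonneg hτ hr l hα
  have hInn : ∀ l, 0 ≤ ∫ α in (S.μ - √3 * S.σ)..(S.μ + √3 * S.σ), S.innerIntegrand τ r a l α := fun l =>
    intervalIntegral.integral_nonneg hle fun α hα => hS.innerIntegrand_nonneg hτ hr l hα
  rw [lintegral_finsetSum']
  · have e2 : ∀ l, ∫⁻ α in Icc (S.μ - √3 * S.σ) (S.μ + √3 * S.σ), ENNReal.ofReal (S.prob l) *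
        (ENNReal.ofReal (2 * Real.pi ^ 2) * ENNReal.ofReal (S.innerIntegrand τ r a l α)) =
        ENNReal.ofReal (2 * Real.pi ^ 2) * ENNReal.ofReal (S.prob l *
          ∫ α in (S.μ - √3 * S.σ)..(S.μ + √3 * S.σ), S.innerIntegrand τ r a l α) := fun l => by
      rw [lintegral_const_mul' _ _ ENNReal.ofReal_ne_top,
        lintegral_const_mul' _ _ ENNReal.ofReal_ne_top, hI,
        ENNReal.ofReal_mul (hS.prob_nonneg l), mul_left_comm]
    simp_rw [e2]
    rw [← Finset.mul_sum, ← ENNReal.ofReal_sum_of_nonneg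
        (fun l _ => mul_nonneg (hS.prob_nonneg l) (hInn l)),
      ← ENNReal.ofReal_mul (by positivity), ← ENNReal.ofReal_mul (by positivity),
      ← ENNReal.ofReal_mul hlam.le]
    congr 1
    field_simp
  · intro l _
    exact ((hintI l).aemeasurable.ennreal_ofReal.const_mul _).const_mul _

end Inner

/-! ### The coverage events -/

/-- The condition `τ < b t / D`, solved for `t`. It holds also for `D = 0` and `D = ∞`. -/
theorem ofReal_lt_ofReal_div_iff {τ b : ℝ} (hτ : 0 < τ) (hb : 0 < b) (t : ℝ) (D : ℝ≥0∞) :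
    ENNReal.ofReal τ < ENNReal.ofReal (b * t) / D ↔
      ENNReal.ofReal (τ / b) * D < ENNReal.ofReal t := by
  have hb0 : ENNReal.ofReal b ≠ 0 := by simpa using hb
  rw [ENNReal.lt_div_iff_mul_lt (Or.inr ENNReal.ofReal_ne_top) (Or.inr (by simpa using hτ)),
    ← ENNReal.mul_lt_mul_iff_right hb0 ENNReal.ofReal_ne_top
      (b := ENNReal.ofReal (τ / b) * D), ← mul_assoc, ← ENNReal.ofReal_mul hb.le,
    ← ENNReal.ofReal_mul hb.le, mul_div_cancel₀ _ hb.ne']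

theorem measurable_polarAngle : Measurable polarAngle := by
  have e : polarAngle = fun x : ℂ => if x.arg < 0 then x.arg + 2 * Real.pi else x.arg := by
    ext x
    unfold polarAngle
    have h1 := Complex.neg_pi_lt_arg x
    have h2 := Complex.arg_le_pi x
    have hp := Real.pi_pos
    split_ifs with h
    · rw [← toIcoMod_add_right Real.two_pi_pos, toIcoMod_eq_self]
      constructor <;> linarith
    · rw [toIcoMod_eq_self]
      constructor <;> linarith
  rw [e]
  exact Measurable.ite (measurableSet_lt Complex.measurable_arg measurable_const)
    (Complex.measurable_arg.add_const _) Complex.measurable_arg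

theorem measurable_userAngle : Measurable userAngle :=
  Measurable.ite (measurableSet_lt measurable_polarAngle measurable_const)
    (measurable_polarAngle.add_const _) (measurable_polarAngle.sub_const _)

theorem measurable_userSection (M : ℕ) [NeZero M] : Measurable (userSection M) := by
  have h1 : Measurable fun x => ((userSection M x : Fin M) : ℕ) :=
    Nat.measurable_floor.comp (measurable_userAngle.div_const _)
  refine measurable_to_countable' fun m => ?_
  have : userSection M ⁻¹' {m} = (fun x => ((userSection M x : Fin M) : ℕ)) ⁻¹' {(m : ℕ)} := by
    ext x; simp [Fin.ext_iff]
  rw [this]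
  exact h1 (measurableSet_singleton _)

/-- The coefficient `τ ‖x‖ ^ a / (P_T M_t M_r)` of interference plus noise in the coverage
condition for the fading gain of a serving base station at `x` with path loss exponent `a`. -/
def Params.threshold (S : Params) (τ : ℝ) (x : ℂ) (a : ℝ) : ℝ≥0∞ :=
  ENNReal.ofReal (τ * ‖x‖ ^ a / (S.PT * (S.Mt * S.Mr)))

theorem Params.measurable_threshold (S : Params) (τ : ℝ) {E : Type*} [MeasurableSpace E]
    {f : E → ℂ} {g : E → ℝ} (hf : Measurable f) (hg : Measurable g) :
    Measurable fun z => S.threshold τ (f z) (g z) := by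
  unfold Params.threshold
  fun_prop

section Network

variable {Ω : Type*} {S : Params} {M : ℕ} [NeZero M] {X : ℕ → Ω → ℂ} {A : ℕ → Fin M → Ω → ℝ}
  {h G : ℕ → Ω → ℝ}

/-- Coverage by base station `i` as a lower bound on its fading gain. The location `0` has to be
excluded: there the path loss has the junk value `0 ^ (-α) = 0`. -/
theorem ofReal_lt_sinr_iff (hS : S.Admissible) {τ : ℝ} (hτ : 0 < τ) {i : ℕ} {ω : Ω}
    (hx : X i ω ≠ 0) :
    ENNReal.ofReal τ < sinr S X A h G i ω ↔
      S.threshold τ (X i ω) (linkMark A h G (fun j => X j ω) i ω).1 *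
        (∑' j : {j // j ≠ i}, S.power (X j ω) (linkMark A h G (fun j => X j ω) j ω) +
          ENNReal.ofReal S.noise) < ENNReal.ofReal (h i ω) := by
  have hMt := hS.Mt_pos
  have hMr := hS.Mr_pos
  have hP := hS.PT_pos
  have hx' : 0 < ‖X i ω‖ := norm_pos_iff.2 hx
  have hpl : 0 < pathLoss X A i ω := Real.rpow_pos_of_pos hx' _
  have e1 : S.PT * (S.Mt * S.Mr) * h i ω * pathLoss X A i ω =
      S.PT * (S.Mt * S.Mr) * pathLoss X A i ω * h i ω := by ring
  have e2 : τ / (S.PT * (S.Mt * S.Mr) * pathLoss X A i ω) =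
      τ * ‖X i ω‖ ^ (A i (userSection M (X i ω)) ω) / (S.PT * (S.Mt * S.Mr)) := by
    rw [pathLoss, Real.rpow_neg hx'.le]
    field_simp
  rw [sinr, e1, ofReal_lt_ofReal_div_iff hτ (by positivity), e2]
  rfl

/-- A base station whose SINR exceeds `τ` has the strictly largest main lobe power: every other
station `j` interferes with gain at least `m_t m_r`, and `τ m_t m_r > M_t M_r`. Hence at most one
base station exceeds `τ`. -/
theorem power_lt_of_lt_sinr (hS : S.Admissible) {τ : ℝ} (hτ : S.Mt * S.Mr / (S.mt * S.mr) < τ)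
    {i j : ℕ} (hij : i ≠ j) {ω : Ω} (hG : S.mt * S.mr ≤ G j ω)
    (hi : ENNReal.ofReal τ < sinr S X A h G i ω) :
    ENNReal.ofReal (S.PT * (S.Mt * S.Mr) * h j ω * pathLoss X A j ω) <
      ENNReal.ofReal (S.PT * (S.Mt * S.Mr) * h i ω * pathLoss X A i ω) := by
  have hτ0 := hS.threshold_pos hτ
  have hP := hS.PT_pos
  have hmm : 0 < S.mt * S.mr := mul_pos hS.mt_pos hS.mr_pos
  rw [sinr, ENNReal.lt_div_iff_mul_lt (Or.inr ENNReal.ofReal_ne_top) (Or.inr (by simpa using hτ0))] at hi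
  refine lt_of_le_of_lt ?_ hi
  have h1 : ENNReal.ofReal (S.PT * G j ω * h j ω * pathLoss X A j ω) ≤ interference S X A h G i ω :=
    ENNReal.le_tsum (f := fun j : {j // j ≠ i} =>
      ENNReal.ofReal (S.PT * G j ω * h j ω * pathLoss X A j ω)) ⟨j, hij.symm⟩
  refine le_trans ?_ (mul_le_mul_right (h1.trans le_self_add) _)
  rw [← ENNReal.ofReal_mul hτ0.le]
  rcases le_total 0 (h j ω * pathLoss X A j ω) with h0 | h0
  · refine ENNReal.ofReal_le_ofReal ?_
    have h2 : S.Mt * S.Mr ≤ τ * G j ω := by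
      rw [div_lt_iff₀ hmm] at hτ
      exact hτ.le.trans (mul_le_mul_of_nonneg_left hG hτ0.le)
    calc S.PT * (S.Mt * S.Mr) * h j ω * pathLoss X A j ω
        = S.PT * (h j ω * pathLoss X A j ω) * (S.Mt * S.Mr) := by ring
      _ ≤ S.PT * (h j ω * pathLoss X A j ω) * (τ * G j ω) :=
          mul_le_mul_of_nonneg_left h2 (mul_nonneg hP.le h0)
      _ = _ := by ring
  · have h3 : S.PT * (S.Mt * S.Mr) * h j ω * pathLoss X A j ω ≤ 0 := by
      have : 0 ≤ S.PT * (S.Mt * S.Mr) := mul_nonneg hP.le (mul_pos hS.Mt_pos hS.Mr_pos).le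
      rw [mul_assoc]
      exact mul_nonpos_of_nonneg_of_nonpos this h0
    rw [ENNReal.ofReal_of_nonpos h3]
    exact bot_le

end Network

section Network

variable {Ω : Type*} [MeasurableSpace Ω] {P : Measure Ω} {S : Params}
  {M : ℕ} {X : ℕ → Ω → ℂ} {A : ℕ → Fin M → Ω → ℝ} {h G : ℕ → Ω → ℝ}

theorem IsHomogeneousPoisson.ae_ne_zero {lam : ℝ} (hX : IsHomogeneousPoisson P lam X) :
    ∀ᵐ ω ∂P, ∀ i, X i ω ≠ 0 := by
  have h0 : ∫⁻ ω, pointCount X {0} ω ∂P = 0 := by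
    rw [hX.lintegral_pointCount (measurableSet_singleton 0) (by simp)]; simp
  rw [lintegral_eq_zero_iff (measurable_pointCount hX.measurable (measurableSet_singleton 0))] at h0
  filter_upwards [h0] with ω hω i hi
  have := (ENNReal.tsum_eq_zero.1 hω) i
  simp [hi] at this

theorem IsNetwork.ae_gain_ge (hS : S.Admissible) (hN : IsNetwork S P X A h G) :
    ∀ᵐ ω ∂P, ∀ j, S.mt * S.mr ≤ G j ω := by
  rw [ae_all_iff]
  intro j
  have hm : MeasurableSet {g : ℝ | S.mt * S.mr ≤ g} := measurableSet_Ici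
  refine ((hN.law_G j).ae_iff (p := fun g => S.mt * S.mr ≤ g) hm.mem).2 ?_
  rw [ae_iff, ← compl_ofPred, ← lintegral_indicator_one hm.compl, lintegral_gainLaw]
  refine Finset.sum_eq_zero fun l _ => ?_
  rw [indicator_of_notMem, mul_zero]
  simpa using hS.gain_ge l

variable [NeZero M]

variable [IsProbabilityMeasure P]

/-- The probability that the fading gain of base station `i` exceeds the coverage threshold,
expressed as an expectation over the locations of the base stations only. -/
theorem IsNetwork.measure_coverage_eq (hN : IsNetwork S P X A h G) {v : ℂ → ℝ → ℝ≥0∞}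
    (hv : Measurable (Function.uncurry v)) (N : ℝ≥0∞) (i : ℕ) :
    MeasurableSet {ω | v (X i ω) (linkMark A h G (fun j => X j ω) i ω).1 *
        (∑' j : {j // j ≠ i}, S.power (X j ω) (linkMark A h G (fun j => X j ω) j ω) + N) <
          ENNReal.ofReal (h i ω)} ∧
    P {ω | v (X i ω) (linkMark A h G (fun j => X j ω) i ω).1 *
        (∑' j : {j // j ≠ i}, S.power (X j ω) (linkMark A h G (fun j => X j ω) j ω) + N) <
          ENNReal.ofReal (h i ω)} =
      ∫⁻ ω, ∫⁻ a, expNeg (v (X i ω) a * N) *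
        expNeg (∑' j : {j // j ≠ i}, S.powerExponent (v (X i ω) a) (X j ω)) ∂S.exponentLaw ∂P := by
  have hXm : Measurable fun ω (j : ℕ) => X j ω := measurable_pi_lambda _ hN.poisson.measurable
  have hKm : Measurable fun ω k => marks A h G k ω := measurable_pi_lambda _ hN.measurable_marks
  have hmap := (indepFun_iff_map_prod_eq_prod_map_map hXm.aemeasurable hKm.aemeasurable).1
    hN.indep_points
  -- the link marks as a function of the locations and the family of all marks
  let q : ℕ → (ℕ → ℂ) × ((ℕ × Fin M) ⊕ (ℕ ⊕ ℕ) → ℝ) → ℝ × ℝ × ℝ := fun j z =>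
    (z.2 (Sum.inl (j, userSection M (z.1 j))), z.2 (Sum.inr (Sum.inl j)), z.2 (Sum.inr (Sum.inr j)))
  have hq : ∀ j, Measurable (q j) := fun j => by
    have h1 : Measurable fun z : ((ℕ × Fin M) ⊕ (ℕ ⊕ ℕ) → ℝ) × Fin M => z.1 (Sum.inl (j, z.2)) :=
      measurable_from_prod_countable_left fun m =>
        (measurable_pi_apply (Sum.inl (j, m)) : Measurable fun w : _ → ℝ => w (Sum.inl (j, m)))
    have h2 : Measurable fun z : (ℕ → ℂ) × ((ℕ × Fin M) ⊕ (ℕ ⊕ ℕ) → ℝ) => userSection M (z.1 j) :=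
      (measurable_userSection M).comp ((measurable_pi_apply j).comp measurable_fst)
    exact (h1.comp (measurable_snd.prodMk h2)).prodMk
      (((measurable_pi_apply _).comp measurable_snd).prodMk
        ((measurable_pi_apply _).comp measurable_snd))
  have hx : ∀ j, Measurable fun z : (ℕ → ℂ) × ((ℕ × Fin M) ⊕ (ℕ ⊕ ℕ) → ℝ) => z.1 j := fun j =>
    (measurable_pi_apply j).comp measurable_fst
  let E : Set ((ℕ → ℂ) × ((ℕ × Fin M) ⊕ (ℕ ⊕ ℕ) → ℝ)) :=
    {z | v (z.1 i) (q i z).1 * (∑' j : {j // j ≠ i}, S.power (z.1 j) (q j z) + N) <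
      ENNReal.ofReal (z.2 (Sum.inr (Sum.inl i)))}
  have hE : MeasurableSet E := by
    refine measurableSet_lt ((hv.comp ((hx i).prodMk (hq i).fst)).mul (Measurable.add_const ?_ N))
      (ENNReal.measurable_ofReal.comp ((measurable_pi_apply _).comp measurable_snd))
    exact Measurable.tsum fun j => S.measurable_power.comp ((hx j).prodMk (hq j))
  have hZ : Measurable fun ω => ((fun j => X j ω), fun k => marks A h G k ω) := hXm.prodMk hKm
  refine ⟨hZ hE, ?_⟩
  have e1 : P {ω | v (X i ω) (linkMark A h G (fun j => X j ω) i ω).1 *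
        (∑' j : {j // j ≠ i}, S.power (X j ω) (linkMark A h G (fun j => X j ω) j ω) + N) <
          ENNReal.ofReal (h i ω)} =
      (P.map fun ω => ((fun j => X j ω), fun k => marks A h G k ω)) E :=
    (Measure.map_apply hZ hE).symm
  have hPm : IsProbabilityMeasure (P.map fun ω k => marks A h G k ω) :=
    Measure.isProbabilityMeasure_map hKm.aemeasurable
  rw [e1, hmap, Measure.prod_apply hE, lintegral_map (measurable_measure_prodMk_left hE) hXm]
  refine lintegral_congr fun ω => ?_
  rw [Measure.map_apply hKm (measurable_prodMk_left hE)]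
  exact hN.measure_lt_fading (fun j => X j ω) i
    (hv.comp (measurable_const.prodMk measurable_id) : Measurable fun a => v (X i ω) a) N

/-- The coverage probability as an integral over the location of the serving base station and its
path loss exponent. As at most one base station covers the user, it is the sum of the coverage
probabilities of the individual stations, to which the Campbell–Mecke formula applies. -/
theorem IsNetwork.measure_lt_maxSinr (hS : S.Admissible) (hN : IsNetwork S P X A h G) {τ : ℝ}
    (hτ : S.Mt * S.Mr / (S.mt * S.mr) < τ) :
    P {ω | ENNReal.ofReal τ < maxSinr S X A h G ω} =
      ∫⁻ a, (ENNReal.ofReal S.lam * ∫⁻ x : ℂ,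
        expNeg (S.threshold τ x a * ENNReal.ofReal S.noise) *
          expNeg (ENNReal.ofReal S.lam * ∫⁻ y, (1 - S.powerLaplace (S.threshold τ x a) y)))
        ∂S.exponentLaw := by
  have := hN.isProbabilityMeasure_markLaw
  have := hN.isProbabilityMeasure_exponentLaw
  have hτ0 := hS.threshold_pos hτ
  set N := ENNReal.ofReal S.noise with hNdef
  have hv : Measurable (Function.uncurry (S.threshold τ)) :=
    S.measurable_threshold τ measurable_fst measurable_snd
  let F : ℕ → Set Ω := fun i => {ω | S.threshold τ (X i ω) (linkMark A h G (fun j => X j ω) i ω).1 *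
        (∑' j : {j // j ≠ i}, S.power (X j ω) (linkMark A h G (fun j => X j ω) j ω) + N) <
          ENNReal.ofReal (h i ω)}
  have hF := fun i => hN.measure_coverage_eq (v := S.threshold τ) hv N i
  have hiff : ∀ᵐ ω ∂P, ∀ i, ω ∈ F i ↔ ENNReal.ofReal τ < sinr S X A h G i ω := by
    filter_upwards [hN.poisson.ae_ne_zero] with ω hω i
    exact (ofReal_lt_sinr_iff hS hτ0 (hω i)).symm
  have hcov : {ω | ENNReal.ofReal τ < maxSinr S X A h G ω} =ᵐ[P] ⋃ i, F i := by
    filter_upwards [hiff] with ω hω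
    refine propext ?_
    change ENNReal.ofReal τ < maxSinr S X A h G ω ↔ ω ∈ ⋃ i, F i
    rw [maxSinr, lt_iSup_iff, mem_iUnion]
    exact exists_congr fun i => (hω i).symm
  have hdisj : Pairwise (Function.onFun (AEDisjoint P) F) := by
    intro i j hij
    change P (F i ∩ F j) = 0
    have : ∀ᵐ ω ∂P, ω ∉ F i ∩ F j := by
      filter_upwards [hiff, hN.ae_gain_ge hS] with ω hω hG hmem
      have h1 := power_lt_of_lt_sinr hS hτ hij (hG j) ((hω i).1 hmem.1)
      have h2 := power_lt_of_lt_sinr hS hτ hij.symm (hG i) ((hω j).1 hmem.2)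
      exact lt_asymm h1 h2
    exact measure_eq_zero_iff_ae_notMem.2 this
  rw [measure_congr hcov, measure_iUnion₀ hdisj fun i => (hF i).1.nullMeasurableSet]
  let W : ℕ → Ω → ℝ → ℝ≥0∞ := fun i ω a => expNeg (S.threshold τ (X i ω) a * N) *
    expNeg (∑' j : {j // j ≠ i}, S.powerExponent (S.threshold τ (X i ω) a) (X j ω))
  have hPF : ∀ i, P (F i) = ∫⁻ ω, ∫⁻ a, W i ω a ∂S.exponentLaw ∂P := fun i => (hF i).2
  have hXm := hN.poisson.measurable
  have hm : ∀ i, Measurable fun z : Ω × ℝ => W i z.1 z.2 := by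
    intro i
    have hvi : Measurable fun z : Ω × ℝ => S.threshold τ (X i z.1) z.2 :=
      S.measurable_threshold τ ((hXm i).comp measurable_fst) measurable_snd
    exact (measurable_expNeg.comp (hvi.mul_const N)).mul (measurable_expNeg.comp
      (Measurable.tsum fun j => S.measurable_powerExponent.comp
        (hvi.prodMk ((hXm j).comp measurable_fst))))
  have hm1 : ∀ i, Measurable fun ω => ∫⁻ a, W i ω a ∂S.exponentLaw := fun i =>
    (hm i).lintegral_prod_right'
  have hm2 : Measurable fun z : Ω × ℝ => ∑' i, W i z.1 z.2 := Measurable.tsum hm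
  have e1 : ∑' i, P (F i) = ∫⁻ a, ∫⁻ ω, ∑' i, W i ω a ∂P ∂S.exponentLaw := by
    clear_value W
    calc ∑' i, P (F i) = ∑' i, ∫⁻ ω, ∫⁻ a, W i ω a ∂S.exponentLaw ∂P := tsum_congr hPF
      _ = ∫⁻ ω, ∑' i, ∫⁻ a, W i ω a ∂S.exponentLaw ∂P :=
        (lintegral_tsum fun i => (hm1 i).aemeasurable).symm
      _ = ∫⁻ ω, ∫⁻ a, ∑' i, W i ω a ∂S.exponentLaw ∂P := lintegral_congr fun ω =>
        (lintegral_tsum fun i => ((hm i).comp measurable_prodMk_left).aemeasurable).symm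
      _ = _ := lintegral_lintegral_swap hm2.aemeasurable
  rw [e1]
  refine lintegral_congr fun a => ?_
  have hva : Measurable fun x => S.threshold τ x a :=
    S.measurable_threshold τ measurable_id measurable_const
  have := hN.poisson.mecke S.measurable_powerExponent
    (fun y => negLog_antitone.comp (S.antitone_powerLaplace y))
    (fun y => continuous_negLog.comp (S.continuous_powerLaplace y))
    (fun s hs y => negLog_ne_top (S.powerLaplace_le_one s y) (S.powerLaplace_ne_zero hs y))
    hva (measurable_expNeg.comp (hva.mul_const N)) (fun x => expNeg_le_one _)
  simp_rw [S.expNeg_powerExponent] at this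
  exact this

end Network

/-! ### The coverage integral in polar coordinates -/

/-- The integral of a radial function in polar coordinates. -/
theorem lintegral_norm_complex {f : ℝ → ℝ≥0∞} (hf : Measurable f) :
    ∫⁻ x : ℂ, f ‖x‖ = ∫⁻ r in Ioi (0 : ℝ), ENNReal.ofReal (2 * Real.pi * r) * f r := by
  have hm : Measurable fun p : ℝ × ℝ => ENNReal.ofReal p.1 * f p.1 := by fun_prop
  rw [← Complex.lintegral_comp_polarCoord_symm]
  have h1 : ∫⁻ p in polarCoord.target, ENNReal.ofReal p.1 • f ‖Complex.polarCoord.symm p‖ =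
      ∫⁻ p in Ioi (0 : ℝ) ×ˢ Ioo (-Real.pi) Real.pi, ENNReal.ofReal p.1 * f p.1 := by
    refine setLIntegral_congr_fun (measurableSet_Ioi.prod measurableSet_Ioo) fun p hp => ?_
    have hp0 : 0 < p.1 := hp.1
    rw [Complex.norm_polarCoord_symm, abs_of_pos hp0, smul_eq_mul]
  rw [h1, Measure.volume_eq_prod, ← Measure.prod_restrict, lintegral_prod _ hm.aemeasurable]
  refine lintegral_congr fun r => ?_
  have hpi := Real.pi_pos
  simp only
  rw [setLIntegral_const, Real.volume_Ioo, mul_right_comm, mul_comm (ENNReal.ofReal r),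
    ← ENNReal.ofReal_mul (by linarith)]
  congr 3
  ring

theorem Params.measurable_outerIntegrand (S : Params) (τ : ℝ) :
    Measurable fun q : ℝ × ℝ => S.outerIntegrand τ q.1 q.2 := by
  have h1 : ∀ l (s : Set ℝ), Measurable fun q : ℝ × ℝ =>
      ∫ α in s, S.innerIntegrand τ q.1 q.2 l α := fun l s => by
    have hm : Measurable fun z : (ℝ × ℝ) × ℝ => S.innerIntegrand τ z.1.1 z.1.2 l z.2 := by
      unfold Params.innerIntegrand
      fun_prop
    exact hm.stronglyMeasurable.integral_prod_right'.measurable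
  unfold Params.outerIntegrand
  simp_rw [intervalIntegral]
  fun_prop

section Admissible

variable {S : Params}

theorem Params.outerIntegrand_nonneg {τ r a : ℝ} (hr : 0 < r) :
    0 ≤ S.outerIntegrand τ r a := mul_nonneg hr.le (Real.exp_nonneg _)

/-- The integrand of the coverage probability at location `x`. The factor `‖x‖` that
`outerIntegrand` contains is the Jacobian of polar coordinates. -/
theorem Params.Admissible.expNeg_coverage (hS : S.Admissible)
    [IsProbabilityMeasure S.markLaw] [IsProbabilityMeasure S.exponentLaw]
    [IsProbabilityMeasure S.gainLaw] {τ : ℝ} (hτ : 0 < τ) {x : ℂ} (hx : x ≠ 0) (a : ℝ) :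
    expNeg (S.threshold τ x a * ENNReal.ofReal S.noise) *
      expNeg (ENNReal.ofReal S.lam * ∫⁻ y, (1 - S.powerLaplace (S.threshold τ x a) y)) =
      ENNReal.ofReal (S.outerIntegrand τ ‖x‖ a / ‖x‖) := by
  have hr : 0 < ‖x‖ := norm_pos_iff.2 hx
  have hle : S.μ - √3 * S.σ ≤ S.μ + √3 * S.σ := by linarith [hS.spread_pos]
  have hs := hS.spread_pos
  have hMt := hS.Mt_pos
  have hMr := hS.Mr_pos
  have hP := hS.PT_pos
  have hlam := hS.lam_pos
  have hn := hS.noise_nonneg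
  have hI : 0 ≤ S.lam * Real.pi ^ 2 / (√3 * S.σ) * ∑ l, S.prob l *
        ∫ α in (S.μ - √3 * S.σ)..(S.μ + √3 * S.σ), S.innerIntegrand τ ‖x‖ a l α := by
    refine mul_nonneg (by positivity) (Finset.sum_nonneg fun l _ => mul_nonneg (hS.prob_nonneg l) ?_)
    exact intervalIntegral.integral_nonneg hle fun α hα => hS.innerIntegrand_nonneg hτ hr l hα
  have hv : 0 ≤ τ * ‖x‖ ^ a / (S.PT * (S.Mt * S.Mr)) := by positivity
  unfold Params.threshold
  rw [hS.laplaceExponent_eq hτ hr a, ← ENNReal.ofReal_mul hv, expNeg_ofReal (mul_nonneg hv hn),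
    expNeg_ofReal hI, ← ENNReal.ofReal_mul (Real.exp_nonneg _), ← Real.exp_add, Params.outerIntegrand,
    mul_div_cancel_left₀ _ hr.ne']
  congr 2
  rw [add_comm, sub_eq_add_neg]
  congr 2
  rw [div_mul_eq_mul_div, mul_assoc S.PT]

/-- The factor of the coverage integral is `λ · 2π / (2√3 σ)`: intensity, angular integral and
density of the path loss exponent. -/
theorem Params.Admissible.lintegral_coverage (hS : S.Admissible)
    [IsProbabilityMeasure S.markLaw] [IsProbabilityMeasure S.exponentLaw]
    [IsProbabilityMeasure S.gainLaw] {τ : ℝ} (hτ : 0 < τ) :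
    ∫⁻ a, (ENNReal.ofReal S.lam * ∫⁻ x : ℂ,
        expNeg (S.threshold τ x a * ENNReal.ofReal S.noise) *
          expNeg (ENNReal.ofReal S.lam * ∫⁻ y, (1 - S.powerLaplace (S.threshold τ x a) y)))
        ∂S.exponentLaw =
      ENNReal.ofReal (S.lam * Real.pi / (√3 * S.σ)) *
        ∫⁻ q in Ioi (0 : ℝ) ×ˢ Icc (S.μ - √3 * S.σ) (S.μ + √3 * S.σ),
          ENNReal.ofReal (S.outerIntegrand τ q.1 q.2) := by
  have hs := hS.spread_pos
  have hpi := Real.pi_pos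
  have hlam := hS.lam_pos
  have hm := (S.measurable_outerIntegrand τ).ennreal_ofReal
  have h1 : ∀ a, ∫⁻ x : ℂ, expNeg (S.threshold τ x a * ENNReal.ofReal S.noise) *
          expNeg (ENNReal.ofReal S.lam * ∫⁻ y, (1 - S.powerLaplace (S.threshold τ x a) y)) =
      ENNReal.ofReal (2 * Real.pi) * ∫⁻ r in Ioi (0 : ℝ), ENNReal.ofReal (S.outerIntegrand τ r a) := by
    intro a
    have hma : Measurable fun r => S.outerIntegrand τ r a :=
      (S.measurable_outerIntegrand τ).comp (measurable_id.prodMk measurable_const)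
    have hne : ∀ᵐ x : ℂ, x ≠ 0 := by simp [ae_iff]
    rw [lintegral_congr_ae (hne.mono fun x hx => hS.expNeg_coverage hτ hx a),
      lintegral_norm_complex (f := fun r => ENNReal.ofReal (S.outerIntegrand τ r a / r)) (by fun_prop),
      ← lintegral_const_mul _ hma.ennreal_ofReal]
    refine setLIntegral_congr_fun measurableSet_Ioi fun r hr => ?_
    have hr0 : 0 < r := hr
    rw [← ENNReal.ofReal_mul (by positivity), ← ENNReal.ofReal_mul (by positivity)]
    congr 1
    field_simp
  simp_rw [h1]
  rw [hS.lintegral_exponentLaw, Measure.volume_eq_prod, ← Measure.prod_restrict,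
    lintegral_prod_symm _ hm.aemeasurable]
  have hmi : Measurable fun a => ∫⁻ r in Ioi (0 : ℝ), ENNReal.ofReal (S.outerIntegrand τ r a) :=
    hm.lintegral_prod_left'
  rw [lintegral_const_mul _ (hmi.const_mul _), lintegral_const_mul _ hmi, ← mul_assoc, ← mul_assoc,
    ← ENNReal.ofReal_mul (by positivity), ← ENNReal.ofReal_mul (by positivity)]
  congr 2
  field_simp

end Admissible

section Network

variable {Ω : Type*} [MeasurableSpace Ω] {P : Measure Ω} {S : Params}
  {M : ℕ} [NeZero M] {X : ℕ → Ω → ℂ} {A : ℕ → Fin M → Ω → ℝ} {h G : ℕ → Ω → ℝ}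

/-- The coverage integral converges and gives the coverage probability. -/
theorem IsNetwork.coverageProb_eq [IsProbabilityMeasure P] (hS : S.Admissible)
    (hN : IsNetwork S P X A h G) {τ : ℝ}
    (hτ : S.Mt * S.Mr / (S.mt * S.mr) < τ) :
    IntegrableOn (fun q : ℝ × ℝ => S.outerIntegrand τ q.1 q.2)
        (Ioi 0 ×ˢ Icc (S.μ - √3 * S.σ) (S.μ + √3 * S.σ)) ∧
      coverageProb S P X A h G τ = S.lam * Real.pi / (√3 * S.σ) *
          ∫ r in Ioi (0 : ℝ), ∫ a in (S.μ - √3 * S.σ)..(S.μ + √3 * S.σ),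
            S.outerIntegrand τ r a := by
  have := hN.isProbabilityMeasure_markLaw
  have := hN.isProbabilityMeasure_exponentLaw
  have := hN.isProbabilityMeasure_gainLaw
  have hτ0 := hS.threshold_pos hτ
  have hs := hS.spread_pos
  have hpi := Real.pi_pos
  have hlam := hS.lam_pos
  have hc : 0 < S.lam * Real.pi / (√3 * S.σ) := by positivity
  have hle : S.μ - √3 * S.σ ≤ S.μ + √3 * S.σ := by linarith
  have key := hN.measure_lt_maxSinr hS hτ
  rw [hS.lintegral_coverage hτ0] at key
  have hnn : ∀ᵐ q ∂(volume.restrict (Ioi (0 : ℝ) ×ˢ Icc (S.μ - √3 * S.σ) (S.μ + √3 * S.σ))),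
      0 ≤ S.outerIntegrand τ q.1 q.2 := by
    filter_upwards [ae_restrict_mem (measurableSet_Ioi.prod measurableSet_Icc)] with q hq
    exact Params.outerIntegrand_nonneg hq.1
  have hfin : ∫⁻ q in Ioi (0 : ℝ) ×ˢ Icc (S.μ - √3 * S.σ) (S.μ + √3 * S.σ),
      ENNReal.ofReal (S.outerIntegrand τ q.1 q.2) ≠ ∞ := fun htop => by
    rw [htop, ENNReal.mul_top (by simpa using hc)] at key
    exact measure_ne_top P _ key
  -- the integral converges because it is a multiple of a probability
  have hint : IntegrableOn (fun q : ℝ × ℝ => S.outerIntegrand τ q.1 q.2)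
      (Ioi 0 ×ˢ Icc (S.μ - √3 * S.σ) (S.μ + √3 * S.σ)) :=
    (lintegral_ofReal_ne_top_iff_integrable
      (S.measurable_outerIntegrand τ).aestronglyMeasurable hnn).1 hfin
  refine ⟨hint, ?_⟩
  have hset : {ω | (τ : EReal) < ((maxSinr S X A h G ω : ℝ≥0∞) : EReal)} =
      {ω | ENNReal.ofReal τ < maxSinr S X A h G ω} := by
    ext ω
    simp only [mem_ofPred_eq]
    rw [← EReal.coe_ennreal_lt_coe_ennreal_iff, EReal.coe_ennreal_ofReal, max_eq_left hτ0.le]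
  have hprod := setIntegral_prod (fun q : ℝ × ℝ => S.outerIntegrand τ q.1 q.2) hint
  rw [coverageProb, hset, measureReal_def, key, ENNReal.toReal_mul, ENNReal.toReal_ofReal hc.le,
    ← ofReal_integral_eq_lintegral_ofReal hint hnn,
    ENNReal.toReal_ofReal (integral_nonneg_of_ae hnn), Measure.volume_eq_prod, hprod]
  simp_rw [intervalIntegral.integral_of_le hle, integral_Icc_eq_integral_Ioc]

/-! ### The rate coverage probability -/

/-- The rate is a strictly increasing function of the SINR. -/
theorem lt_rate_iff {b : ℝ} (hb : 0 < b) (γ : ℝ) (m : ℝ≥0∞) :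
    (γ : EReal) < (b : EReal) * (ENNReal.log (1 + m) / ((Real.log 2 : ℝ) : EReal)) ↔
      (((2 : ℝ) ^ (γ / b) - 1 : ℝ) : EReal) < (m : EReal) := by
  have hlog : 0 < Real.log 2 := Real.log_pos one_lt_two
  rcases eq_or_ne m ∞ with rfl | hm
  · rw [add_top, ENNReal.log_top, EReal.top_div_of_pos_ne_top (by exact_mod_cast hlog)
      (EReal.coe_ne_top _), EReal.coe_mul_top_of_pos hb, EReal.coe_ennreal_top]
    exact iff_of_true (EReal.coe_lt_top _) (EReal.coe_lt_top _)
  lift m to NNReal using hm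
  have hm0 : 0 ≤ (m : ℝ) := m.2
  have e : ENNReal.log (1 + (m : ℝ≥0∞)) = ((Real.log (1 + m) : ℝ) : EReal) := by
    rw [← ENNReal.ofReal_coe_nnreal, ← ENNReal.ofReal_one, ← ENNReal.ofReal_add zero_le_one hm0,
      ENNReal.log_ofReal_of_pos (by positivity)]
  rw [e, ← EReal.coe_div, ← EReal.coe_mul, EReal.coe_lt_coe_iff,
    show (((m : NNReal) : ℝ≥0∞) : EReal) = ((m : ℝ) : EReal) from rfl, EReal.coe_lt_coe_iff,
    sub_lt_iff_lt_add, add_comm (m : ℝ), Real.rpow_def_of_pos two_pos,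
    ← Real.lt_log_iff_exp_lt (by positivity), ← div_lt_iff₀' hb, lt_div_iff₀ hlog, mul_comm]

theorem rateCoverageProb_eq (hS : S.Admissible) (γ : ℝ) :
    rateCoverageProb S P X A h G γ = coverageProb S P X A h G (2 ^ (γ / S.BW) - 1) := by
  unfold rateCoverageProb coverageProb rate
  simp_rw [lt_rate_iff hS.BW_pos]

end Network

end SmallCell

end

theorem theorem2 {Ω : Type*} [MeasurableSpace Ω] (P : Measure Ω) [IsProbabilityMeasure P]
    (S : SmallCell.Params) (hS : S.Admissible) (M : ℕ) [NeZero M]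
    (X : ℕ → Ω → ℂ) (A : ℕ → Fin M → Ω → ℝ) (h G : ℕ → Ω → ℝ)
    (hN : SmallCell.IsNetwork S P X A h G) :
    (∀ τ : ℝ, S.Mt * S.Mr / (S.mt * S.mr) < τ →
      (∀ r : ℝ, 0 < r → ∀ a ∈ Set.Icc (S.μ - √3 * S.σ) (S.μ + √3 * S.σ), ∀ l : Fin 4,
        IntervalIntegrable (S.innerIntegrand τ r a l) volume
          (S.μ - √3 * S.σ) (S.μ + √3 * S.σ)) ∧
      IntegrableOn (fun q : ℝ × ℝ => S.outerIntegrand τ q.1 q.2)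
        (Set.Ioi 0 ×ˢ Set.Icc (S.μ - √3 * S.σ) (S.μ + √3 * S.σ)) ∧
      SmallCell.coverageProb S P X A h G τ =
        S.lam * Real.pi / (√3 * S.σ) *
          ∫ r in Set.Ioi (0 : ℝ), ∫ a in (S.μ - √3 * S.σ)..(S.μ + √3 * S.σ),
            S.outerIntegrand τ r a) ∧
    ∀ γ : ℝ, SmallCell.rateCoverageProb S P X A h G γ =
      SmallCell.coverageProb S P X A h G (2 ^ (γ / S.BW) - 1) :=
  ⟨fun _ hτ => ⟨fun _ hr a _ l => hS.intervalIntegrable_innerIntegrand (hS.threshold_pos hτ) hr a l,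
    hN.coverageProb_eq hS hτ⟩, SmallCell.rateCoverageProb_eq hS⟩
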